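/- Let $k$ be an infinite field, let $U$ be a smooth separated $k$-scheme of finite type, let $X$ be a smooth separated affine $k$-scheme of finite type, let $Y\subset X$ be a closed subscheme, and let $n\ge 0$ be an integer. Definitions. For a $k$-scheme $S$, an explicit framed correspondence of level $n$ from $S$ to $(X,X-Y)$ is a tuple $(Z,\mathcal V,\varphi,g)$ in which $Z\subset\mathbb A^n_S$ is a reduced closed subscheme that is finite over $S$, $e\colon\mathcal V\to\mathbb A^n_S$ is an étale morphism with $e^{-1}(Z)\to Z$ an isomorphism (a Nisnevich neighbourhood of $Z$), and $\varphi=(\varphi_1,\dots,\varphi_n)\colon\mathcal V\to\mathbb A^n$ and $g\colon\mathcal V\to X$ are morphisms of $k$-schemes such that $Z=(\varphi,g)^{-1}(0\times Y)$ as closed sets. The set $\mathrm{Fr}_n(S,X/(X-Y))$ consists of the classes of such tuples under the equivalence relation that identifies two tuples with the same $Z$ which become equal on a common smaller Nisnevich neighbourhood of $Z$. The subset $\mathrm{Fr}^{\mathrm{qf}}_n(S,X/(X-Y))$ consists of the classes that have a representative for which the scheme-theoretic preimage $\varphi^{-1}(0)$ is quasi-finite over $S$. Let $x_\infty,x_1,\dots,x_n$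 be the homogeneous coordinates on $\mathbb P^n$, and let $\mathcal I(0\times Y)$ be the ideal of $0\times Y$ in $k[\mathbb A^n_X]$. A vector $s=(s_i)\in\Gamma(\mathbb P^n_X,\mathcal O(d))^n$ is called admissible if $s_i/x_\infty^d\equiv x_i$ modulo $\mathcal I(0\times Y)^2$ for $i=1,\dots,n$. For an admissible $s$ and $\alpha=[(Z,\mathcal V,\varphi,g)]\in\mathrm{Fr}_n(S,X/(X-Y))$, let $\alpha^s\in\mathrm{Fr}_n(S,X/(X-Y))$ be the class of $(Z,\mathcal V',\varphi^s,g)$, where $\varphi^s_i=(s_i/x_\infty^d)\circ(\varphi,g)$ and $\mathcal V'\subset\mathcal V$ is the open neighbourhood of $Z$ obtained by removing the points of $(\varphi^s,g)^{-1}(0\times Y)$ that are not in $Z$. Finally, let $\lambda$ be the coordinate on $\mathbb A^1$ and, for $d\ge 1$, let $x=(x_ix_\infty^{d-1})_i$. For an admissible $s$ of degree $d$ and $\alpha\in\mathrm{Fr}_n(U,X/(X-Y))$, let $\alpha^{\lambda s+(1-\lambda)x}\in\mathrm{Fr}_n(U\times\mathbb A^1,X/(X-Y))$ be obtained in the same way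 from the pullback of $\alpha$ along the projection $U\times\mathbb A^1\to U$ and the family of sections $\lambda s+(1-\lambda)x$ over $\mathbb A^1\times\mathbb P^n\times X$. Proposition. (a) For every $\alpha\in\mathrm{Fr}_n(U,X/(X-Y))$ there are an integer $d>0$ and an admissible vector $s\in\Gamma(\mathbb P^n_X,\mathcal O(d))^n$ such that $\alpha^s\in\mathrm{Fr}^{\mathrm{qf}}_n(U,X/(X-Y))$. (b) For every $\alpha\in\mathrm{Fr}^{\mathrm{qf}}_n(U,X/(X-Y))$ there are an integer $d>0$ and an admissible vector $s\in\Gamma(\mathbb P^n_X,\mathcal O(d))^n$ such that $\alpha^{\lambda s+(1-\lambda)x}\in\mathrm{Fr}^{\mathrm{qf}}_n(U\times\mathbb A^1,X/(X-Y))$. -/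

import Mathlib

open CategoryTheory Limits AlgebraicGeometry TopologicalSpace

universe u

noncomputable section

namespace FramedCorrespondence

/-! ### Affine spaces, reduced closed subschemes, values of functions -/

/-- The affine space `𝔸ⁿ_S`. -/
abbrev Aff (n : ℕ) (S : Scheme.{u}) : Scheme.{u} := AffineSpace (ULift.{u} (Fin n)) S

/-- The projection `𝔸ⁿ_S ⟶ S`. -/
abbrev Aff.pr (n : ℕ) (S : Scheme.{u}) : Aff n S ⟶ S := Aff n S ↘ S

/-- The inclusion of a closed subset `Z` of `T`, endowed with its reduced scheme structure. -/
abbrev redι {T : Scheme.{u}} (Z : Closeds T) :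
    (Scheme.IdealSheafData.vanishingIdeal Z).subscheme ⟶ T :=
  (Scheme.IdealSheafData.vanishingIdeal Z).subschemeι

/-- The regular function `f` on `V` vanishes at the point `v`: its value in the residue field
of `v` is zero. -/
def VanishesAt {V : Scheme.{u}} (f : Γ(V, ⊤)) (v : V) : Prop := V.Γevaluation v f = 0

lemma vanishesAt_iff {V : Scheme.{u}} (f : Γ(V, ⊤)) (v : V) :
    VanishesAt f v ↔ v ∉ V.basicOpen f :=
  Scheme.evaluation_eq_zero_iff_notMem_basicOpen _ v _ f

lemma vanishesAt_appTop {V W : Scheme.{u}} (w : W ⟶ V) (f : Γ(V, ⊤)) (x : W) :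
    VanishesAt (w.appTop f) x ↔ VanishesAt f (w x) := by
  unfold VanishesAt
  rw [← Scheme.Γevaluation_naturality_apply]
  exact map_eq_zero_iff _ (RingHom.injective (w.residueFieldMap x).hom)

lemma appTop_congr {T V V' W : Scheme.{u}} {f : T ⟶ V} {g : V ⟶ W} {f' : T ⟶ V'} {g' : V' ⟶ W}
    (h : f ≫ g = f' ≫ g') (x : Γ(W, ⊤)) :
    f.appTop (g.appTop x) = f'.appTop (g'.appTop x) := by
  rw [← CommRingCat.comp_apply, ← CommRingCat.comp_apply, ← Scheme.Hom.comp_appTop,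
    ← Scheme.Hom.comp_appTop, h]

/-! ### Explicit framed correspondences -/

/-- `(V, Z) ⟶ (T, Z)` is a Nisnevich neighbourhood of the closed subset `Z` of `T`: the morphism
`e : V ⟶ T` is étale, and its base change `e⁻¹(Z) ⟶ Z` to the reduced closed subscheme `Z` is an
isomorphism; that is, `Z` lifts to a closed subscheme of `V` which is the preimage of `Z`. -/
structure IsNisnevichNhd {V T : Scheme.{u}} (e : V ⟶ T) (Z : Closeds T) : Prop where
  etale : Etale e
  isPullback : ∃ c, IsPullback c (𝟙 _) e (redι Z)

variable {B : Scheme.{u}}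

/-- An explicit framed correspondence `(Z, V, φ, g)` of level `n` from the `B`-scheme `S` to the
pair `(X, X - Y)`, where `Y` is a closed subset of the `B`-scheme `X`. -/
structure ExplicitCorr (n : ℕ) (S X : Over B) (Y : Closeds X.left) where
  /-- the support, a closed subset of `𝔸ⁿ_S` (with its reduced structure) -/
  Z : Closeds (Aff n S.left)
  /-- the Nisnevich neighbourhood -/
  V : Scheme.{u}
  /-- its structure morphism -/
  e : V ⟶ Aff n S.left
  /-- the framing functions `φ = (φ₁, …, φₙ) : V ⟶ 𝔸ⁿ` -/
  φ : Fin n → Γ(V, ⊤)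
  /-- the regular map to `X` -/
  g : V ⟶ X.left
  g_over : g ≫ X.hom = e ≫ Aff.pr n S.left ≫ S.hom
  finite : IsFinite (redι Z ≫ Aff.pr n S.left)
  nhd : IsNisnevichNhd e Z
  /-- `Z = (φ, g)⁻¹(0 × Y)` -/
  support : ∀ v : V, e v ∈ Z ↔ (∀ i, VanishesAt (φ i) v) ∧ g v ∈ Y

namespace ExplicitCorr

variable {n : ℕ} {S X : Over B} {Y : Closeds X.left}

/-- `c` is obtained from `a` by shrinking the Nisnevich neighbourhood of the support. -/
def Refines (c a : ExplicitCorr n S X Y) : Prop :=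
  c.Z = a.Z ∧ ∃ w : c.V ⟶ a.V,
    w ≫ a.e = c.e ∧ (∀ i, w.appTop (a.φ i) = c.φ i) ∧ w ≫ a.g = c.g

/-- Two explicit correspondences are identified if they have a common shrinking. -/
def Rel (a b : ExplicitCorr n S X Y) : Prop :=
  ∃ c : ExplicitCorr n S X Y, c.Refines a ∧ c.Refines b

/-- The morphism `φ : V ⟶ 𝔸ⁿ`, written over `S` as `V ⟶ 𝔸ⁿ_S`. -/
def framing (a : ExplicitCorr n S X Y) : a.V ⟶ Aff n S.left :=
  AffineSpace.homOfVector (a.e ≫ Aff.pr n S.left) (fun i => a.φ i.down)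

/-- The zero section `S ⟶ 𝔸ⁿ_S`. -/
def zeroSection (n : ℕ) (S : Scheme.{u}) : S ⟶ Aff n S :=
  AffineSpace.homOfVector (𝟙 S) (fun _ => 0)

/-- The structure morphism `φ⁻¹(0) ⟶ S` of the scheme-theoretic preimage of zero. -/
def zeroFibre (a : ExplicitCorr n S X Y) :
    pullback a.framing (zeroSection n S.left) ⟶ S.left :=
  pullback.snd _ _

/-- The scheme `φ⁻¹(0)` is quasi-finite over `S`: of finite type with finite fibres. -/
structure IsQuasiFinite (a : ExplicitCorr n S X Y) : Prop where
  locallyOfFiniteType : LocallyOfFiniteType a.zeroFibre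
  quasiCompact : QuasiCompact a.zeroFibre
  locallyQuasiFinite : LocallyQuasiFinite a.zeroFibre

end ExplicitCorr

/-- The set `Fr_n(S, X/(X - Y))` of framed correspondences of level `n`. -/
def Fr (n : ℕ) (S X : Over B) (Y : Closeds X.left) : Type (u + 1) :=
  Quot (ExplicitCorr.Rel (n := n) (S := S) (X := X) (Y := Y))

/-- The subset `Fr_n^qf(S, X/(X - Y))` of quasi-finite framed correspondences: those which can be
represented by some `(Z, V, φ, g)` with `φ⁻¹(0)` quasi-finite over `S`. -/
def Frqf (n : ℕ) (S X : Over B) (Y : Closeds X.left) : Set (Fr n S X Y) :=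
  {α | ∃ a : ExplicitCorr n S X Y, Quot.mk _ a = α ∧ a.IsQuasiFinite}

/-! ### Base change -/

lemma exists_redι_lift {T T' : Scheme.{u}} (m : T' ⟶ T) (Z : Closeds T) (Z' : Closeds T')
    (h : ∀ x ∈ Z', m x ∈ Z) : ∃ k, k ≫ redι Z = redι Z' ≫ m := by
  have hk : (redι Z).ker ≤ (redι Z' ≫ m).ker := by
    rw [Scheme.IdealSheafData.ker_subschemeι]
    change _ ≤ (Scheme.IdealSheafData.vanishingIdeal Z').map m
    rw [Scheme.IdealSheafData.le_map_iff_comap_le,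
      ← Scheme.IdealSheafData.le_support_iff_le_vanishingIdeal]
    intro x hx
    rw [Scheme.IdealSheafData.support_comap]
    change m x ∈ ((Scheme.IdealSheafData.vanishingIdeal Z).support : Set T)
    rw [Scheme.IdealSheafData.coe_support_vanishingIdeal]
    exact h x hx
  exact ⟨IsClosedImmersion.lift _ _ hk, IsClosedImmersion.lift_fac _ _ hk⟩

namespace ExplicitCorr

variable {n : ℕ} {S S' X : Over B} {Y : Closeds X.left}

/-- The map `𝔸ⁿ_{S'} ⟶ 𝔸ⁿ_S` induced by `S' ⟶ S`. -/
abbrev affMap (n : ℕ) {T T' : Scheme.{u}} (h : T' ⟶ T) : Aff n T' ⟶ Aff n T :=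
  AffineSpace.map (ULift.{u} (Fin n)) h

/-- The pullback of an explicit framed correspondence along `h : S' ⟶ S`. -/
def baseChange (h : S' ⟶ S) (a : ExplicitCorr n S X Y) : ExplicitCorr n S' X Y where
  Z := a.Z.preimage (affMap n h.left).continuous
  V := pullback a.e (affMap n h.left)
  e := pullback.snd _ _
  φ := fun i => (pullback.fst a.e (affMap n h.left)).appTop (a.φ i)
  g := pullback.fst _ _ ≫ a.g
  g_over := by
    rw [Category.assoc, a.g_over, pullback.condition_assoc, AffineSpace.map_over_assoc, Over.w]
  finite := by
    obtain ⟨k, hk⟩ := exists_redι_lift (affMap n h.left) a.Z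
      (a.Z.preimage (affMap n h.left).continuous) (fun _ hx => hx)
    have hP := (IsPullback.of_hasPullback (redι a.Z) (affMap n h.left)).paste_vert
      (AffineSpace.isPullback_map (n := ULift.{u} (Fin n)) h.left)
    have hfin : IsFinite (pullback.snd (redι a.Z) (affMap n h.left) ≫ Aff.pr n S'.left) :=
      MorphismProperty.of_isPullback (P := @IsFinite) hP a.finite
    have hl : pullback.lift k _ hk ≫ pullback.snd (redι a.Z) (affMap n h.left) =
        redι (a.Z.preimage (affMap n h.left).continuous) := pullback.lift_snd _ _ _
    have hcl : IsClosedImmersion (pullback.lift k _ hk) := by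
      have : IsClosedImmersion (pullback.lift k _ hk ≫
          pullback.snd (redι a.Z) (affMap n h.left)) := by rw [hl]; infer_instance
      exact IsClosedImmersion.of_comp_isClosedImmersion _
        (pullback.snd (redι a.Z) (affMap n h.left))
    rw [← hl, Category.assoc]
    infer_instance
  nhd := by
    have := a.nhd.etale
    refine ⟨inferInstance, ?_⟩
    obtain ⟨c, hc⟩ := a.nhd.isPullback
    obtain ⟨k, hk⟩ := exists_redι_lift (affMap n h.left) a.Z
      (a.Z.preimage (affMap n h.left).continuous) (fun _ hx => hx)
    have h₁ : IsPullback (k ≫ c) (𝟙 _) a.e (k ≫ redι a.Z) :=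
      (IsPullback.of_vert_isIso ⟨by simp⟩ : IsPullback k (𝟙 _) (𝟙 _) k).paste_horiz hc
    have hw : (k ≫ c) ≫ a.e = redι (a.Z.preimage (affMap n h.left).continuous) ≫
        affMap n h.left := by rw [← hk, h₁.w, Category.id_comp]
    refine ⟨pullback.lift (k ≫ c) _ hw, ?_⟩
    refine IsPullback.of_right (h₁₂ := pullback.fst a.e (affMap n h.left))
      (h₂₂ := affMap n h.left) (v₁₃ := a.e) ?_
      (by rw [Category.id_comp]; exact pullback.lift_snd _ _ _)
      (IsPullback.of_hasPullback a.e (affMap n h.left))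
    rw [pullback.lift_fst, ← hk]
    exact h₁
  support := by
    intro v
    have hv : (affMap n h.left) (pullback.snd a.e (affMap n h.left) v) =
        a.e (pullback.fst a.e (affMap n h.left) v) := by
      rw [← Scheme.Hom.comp_apply, ← Scheme.Hom.comp_apply, pullback.condition]
    have h₁ := a.support (pullback.fst a.e (affMap n h.left) v)
    change (affMap n h.left) (pullback.snd a.e (affMap n h.left) v) ∈ a.Z ↔ _
    rw [hv, h₁]
    simp only [vanishesAt_appTop, Scheme.Hom.comp_apply]

lemma baseChange_refines (h : S' ⟶ S) {c a : ExplicitCorr n S X Y} (hc : c.Refines a) :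
    (c.baseChange h).Refines (a.baseChange h) := by
  obtain ⟨hZ, w, he, hφ, hg⟩ := hc
  have hw : (pullback.fst c.e (affMap n h.left) ≫ w) ≫ a.e =
      pullback.snd c.e (affMap n h.left) ≫ affMap n h.left := by
    rw [Category.assoc, he, pullback.condition]
  refine ⟨?_, pullback.lift (pullback.fst c.e (affMap n h.left) ≫ w) (pullback.snd _ _) hw,
    ?_, ?_, ?_⟩
  · simp only [baseChange, hZ]
  · exact pullback.lift_snd _ _ _
  · intro i
    simp only [baseChange]
    rw [← hφ i]
    exact appTop_congr (pullback.lift_fst _ _ _) _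
  · simp only [baseChange]
    rw [pullback.lift_fst_assoc, Category.assoc, hg]

end ExplicitCorr

/-- The pullback `Fr_n(S, X/(X - Y)) ⟶ Fr_n(S', X/(X - Y))` along `h : S' ⟶ S`. -/
def Fr.baseChange {n : ℕ} {S S' X : Over B} {Y : Closeds X.left} (h : S' ⟶ S) :
    Fr n S X Y → Fr n S' X Y :=
  Quot.map (ExplicitCorr.baseChange h) fun _ _ ⟨c, h₁, h₂⟩ =>
    ⟨c.baseChange h, ExplicitCorr.baseChange_refines h h₁, ExplicitCorr.baseChange_refines h h₂⟩

/-! ### Sections of `𝒪(d)` on `ℙⁿ × X` for affine `X` -/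

section Sections

open MvPolynomial

variable {A : Type*} [CommRing A]

/-- The ideal of `0 × Y` in `A[x₁, …, xₙ]`, where `J` is the ideal of `Y` in `A`. -/
def idealZeroTimes (n : ℕ) (J : Ideal A) : Ideal (MvPolynomial (Fin n) A) :=
  Ideal.span (Set.range X) ⊔ J.map C

/-- The function `s / x_∞ ^ d` on `𝔸ⁿ` defined by a form `s` of degree `d` on `ℙⁿ`. The variable
`none` is `x_∞` and the variable `some i` is `x_i`. -/
def dehomogenize {n : ℕ} (s : MvPolynomial (Option (Fin n)) A) : MvPolynomial (Fin n) A :=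
  aeval (fun o : Option (Fin n) => o.elim 1 X) s

/-- A vector `s = (s₁, …, sₙ)` of global sections of `𝒪(d)` on `ℙⁿ × Spec A`, that is, of forms of
degree `d` over `A` in `x_∞, x₁, …, xₙ`, such that `s_i / x_∞ ^ d` agrees with `x_i` modulo
the square of the ideal of `0 × Y`, where `J` is the ideal of the closed subscheme `Y`. -/
structure AdmissibleSection (J : Ideal A) (n d : ℕ) where
  /-- the sections -/
  s : Fin n → MvPolynomial (Option (Fin n)) A
  isHomogeneous : ∀ i, (s i).IsHomogeneous d
  congr : ∀ i, dehomogenize (s i) - X i ∈ idealZeroTimes n J ^ 2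

/-- The vector of sections `λ s + (1 - λ) x` of `𝒪(d)` on `𝔸¹ × ℙⁿ × Spec A`, where `λ` is the
coordinate on `𝔸¹` and `x = (x_i x_∞ ^ (d - 1))`. -/
def AdmissibleSection.linearHomotopy {J : Ideal A} {n d : ℕ} (s : AdmissibleSection J n d)
    (hd : 0 < d) : AdmissibleSection (J.map (Polynomial.C : A →+* Polynomial A)) n d where
  s := fun i =>
    C (Polynomial.X : Polynomial A) * map Polynomial.C (s.s i) +
      C (1 - Polynomial.X : Polynomial A) * (X (some i) * X none ^ (d - 1))
  isHomogeneous := by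
    intro i
    refine IsHomogeneous.add ?_ ?_
    · simpa using (isHomogeneous_C _ _).mul ((s.isHomogeneous i).map Polynomial.C)
    · have h := (isHomogeneous_C (Option (Fin n)) (1 - Polynomial.X : Polynomial A)).mul
        ((isHomogeneous_X (Polynomial A) (some i)).mul
          ((isHomogeneous_X (Polynomial A) (none : Option (Fin n))).pow (d - 1)))
      have hd' : 0 + (1 + 1 * (d - 1)) = d := by omega
      rwa [hd'] at h
  congr := by
    intro i
    have h₁ : dehomogenize (map (Polynomial.C : A →+* Polynomial A) (s.s i)) =
        map Polynomial.C (dehomogenize (s.s i)) := by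
      have h := MvPolynomial.hom_eval₂ (s.s i) (C : A →+* MvPolynomial (Fin n) A)
        (map (Polynomial.C : A →+* Polynomial A)) (fun o : Option (Fin n) => o.elim 1 X)
      rw [dehomogenize, dehomogenize, aeval_def, aeval_def, eval₂_map, algebraMap_eq,
        algebraMap_eq, h]
      congr 1
      · ext a : 1
        simp
      · ext o : 1
        cases o <;> simp
    have h₂ : map (Polynomial.C : A →+* Polynomial A) (dehomogenize (s.s i) - X i) ∈
        idealZeroTimes n (J.map (Polynomial.C : A →+* Polynomial A)) ^ 2 := by
      have hle : (idealZeroTimes n J).map (map (Polynomial.C : A →+* Polynomial A)) ≤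
          idealZeroTimes n (J.map (Polynomial.C : A →+* Polynomial A)) := by
        unfold idealZeroTimes
        rw [Ideal.map_sup, Ideal.map_span, Ideal.map_map, Ideal.map_map]
        refine sup_le_sup (Ideal.span_mono ?_) (le_of_eq ?_)
        · rintro _ ⟨_, ⟨j, rfl⟩, rfl⟩
          exact ⟨j, by simp⟩
        · congr 1
          ext a : 1
          simp
      refine Ideal.pow_right_mono hle 2 ?_
      rw [← Ideal.map_pow]
      exact Ideal.mem_map_of_mem _ (s.congr i)
    have h₃ : dehomogenize (C (Polynomial.X : Polynomial A) * map Polynomial.C (s.s i) +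
        C (1 - Polynomial.X : Polynomial A) * (X (some i) * X none ^ (d - 1))) - X i =
        C (Polynomial.X : Polynomial A) *
          map (Polynomial.C : A →+* Polynomial A) (dehomogenize (s.s i) - X i) := by
      rw [(map (Polynomial.C : A →+* Polynomial A)).map_sub, ← h₁]
      simp only [dehomogenize, map_add, map_mul, map_pow, aeval_X, aeval_C, algebraMap_eq,
        Option.elim, one_pow, mul_one, map_X, map_sub, map_one]
      ring
    rw [h₃]
    exact Ideal.mul_mem_left _ _ h₂

end Sections

/-! ### The action of sections on framed correspondences -/

namespace ExplicitCorr

variable {n d : ℕ} {S X : Over B} {Y : Closeds X.left} {A : Type*} [CommRing A] {J : Ideal A}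

/-- The functions `ζ ∘ (φ, g)`, where `ζ` is given by the polynomials `s_i / x_∞ ^ d` with
coefficients in a ring `A` that maps to the regular functions on `V`. -/
def twistφ (a : ExplicitCorr n S X Y) (θ : A →+* Γ(a.V, ⊤)) (s : AdmissibleSection J n d)
    (i : Fin n) : Γ(a.V, ⊤) :=
  MvPolynomial.eval₂ θ a.φ (dehomogenize (s.s i))

/-- The set of points of `V` outside the part of `(ζ ∘ (φ, g), g)⁻¹(0 × Y)` which is not in `Z`. -/
def twistSet (a : ExplicitCorr n S X Y) (θ : A →+* Γ(a.V, ⊤)) (s : AdmissibleSection J n d) :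
    Set a.V :=
  {v | (∀ i, VanishesAt (a.twistφ θ s i) v) ∧ a.g v ∈ Y → a.e v ∈ a.Z}

/-- The functions in `θ J` vanish on `g⁻¹(Y)`. -/
def Compatible (a : ExplicitCorr n S X Y) (θ : A →+* Γ(a.V, ⊤)) (J : Ideal A) : Prop :=
  ∀ v, a.g v ∈ Y → ∀ j ∈ J, VanishesAt (θ j) v

/-- The value at the point `v` of a polynomial in the framing functions. -/
def value (a : ExplicitCorr n S X Y) (θ : A →+* Γ(a.V, ⊤)) (v : a.V) :
    MvPolynomial (Fin n) A →+* a.V.residueField v :=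
  (a.V.Γevaluation v).hom.comp (MvPolynomial.eval₂Hom θ a.φ)

lemma value_eq_zero_of_mem_map (a : ExplicitCorr n S X Y) (θ : A →+* Γ(a.V, ⊤))
    (hθ : a.Compatible θ J) {v : a.V} (hv : a.g v ∈ Y) {p : MvPolynomial (Fin n) A}
    (hp : p ∈ J.map MvPolynomial.C) : a.value θ v p = 0 := by
  have hle : J.map MvPolynomial.C ≤ RingHom.ker (a.value θ v) := by
    rw [Ideal.map_le_iff_le_comap]
    intro j hj
    have := hθ v hv j hj
    simpa [value, VanishesAt, RingHom.mem_ker] using this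
  exact hle hp

lemma value_eq_zero_of_mem_ideal (a : ExplicitCorr n S X Y) (θ : A →+* Γ(a.V, ⊤))
    (hθ : a.Compatible θ J) {v : a.V} (hv : a.e v ∈ a.Z) {p : MvPolynomial (Fin n) A}
    (hp : p ∈ idealZeroTimes n J) : a.value θ v p = 0 := by
  have hle : idealZeroTimes n J ≤ RingHom.ker (a.value θ v) := by
    refine sup_le (Ideal.span_le.2 ?_) fun p hp =>
      a.value_eq_zero_of_mem_map θ hθ ((a.support v).1 hv).2 hp
    rintro _ ⟨j, rfl⟩
    have := ((a.support v).1 hv).1 j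
    simpa [value, VanishesAt, RingHom.mem_ker] using this
  exact hle hp

lemma vanishesAt_twistφ (a : ExplicitCorr n S X Y) (θ : A →+* Γ(a.V, ⊤))
    (hθ : a.Compatible θ J) (s : AdmissibleSection J n d) {v : a.V} (hv : a.e v ∈ a.Z)
    (i : Fin n) : VanishesAt (a.twistφ θ s i) v := by
  change a.value θ v (dehomogenize (s.s i)) = 0
  have h₁ := a.value_eq_zero_of_mem_ideal θ hθ hv (Ideal.pow_le_self two_ne_zero (s.congr i))
  have h₂ := a.value_eq_zero_of_mem_ideal θ hθ hv (p := MvPolynomial.X i)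
    (Ideal.mem_sup_left (Ideal.subset_span ⟨i, rfl⟩))
  rwa [map_sub, h₂, sub_zero] at h₁

lemma exists_linear_expansion {J : Ideal A} {p : MvPolynomial (Fin n) A}
    (hp : p ∈ idealZeroTimes n J ^ 2) :
    ∃ m : Fin n → MvPolynomial (Fin n) A, (∀ j, m j ∈ idealZeroTimes n J) ∧
      p - ∑ j, m j * MvPolynomial.X j ∈ J.map MvPolynomial.C := by
  have h₁ : p ∈ idealZeroTimes n J * Ideal.span (Set.range MvPolynomial.X) ⊔
      J.map MvPolynomial.C := by
    rw [pow_two] at hp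
    conv at hp => enter [1, 2]; rw [idealZeroTimes]
    rw [Ideal.mul_sup] at hp
    have hle := sup_le_sup (le_refl (idealZeroTimes n J * Ideal.span (Set.range MvPolynomial.X)))
      (Ideal.mul_le_right (I := idealZeroTimes n J) (J := J.map MvPolynomial.C))
    exact hle hp
  obtain ⟨q, hq, r, hr, rfl⟩ := Submodule.mem_sup.1 h₁
  rw [← smul_eq_mul, Ideal.span, Submodule.mem_ideal_smul_span_iff_exists_sum] at hq
  obtain ⟨m, hm, rfl⟩ := hq
  refine ⟨m, hm, ?_⟩
  rw [Finsupp.sum_fintype _ _ (by simp)]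
  simpa using hr

lemma isOpen_twistSet (a : ExplicitCorr n S X Y) (θ : A →+* Γ(a.V, ⊤))
    (hθ : a.Compatible θ J) (s : AdmissibleSection J n d) : IsOpen (a.twistSet θ s) := by
  choose m hm hr using fun i => exists_linear_expansion (s.congr i)
  let N : Matrix (Fin n) (Fin n) (MvPolynomial (Fin n) A) := 1 + Matrix.of m
  let δ : Γ(a.V, ⊤) := MvPolynomial.eval₂Hom θ a.φ N.det
  have hδ : ∀ v, a.V.Γevaluation v δ = (N.map (a.value θ v)).det := fun v =>
    RingHom.map_det (a.value θ v) N
  rw [isOpen_iff_forall_mem_open]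
  intro v hv
  by_cases hvZ : a.e v ∈ a.Z
  · refine ⟨a.V.basicOpen δ, ?_, (a.V.basicOpen δ).isOpen, ?_⟩
    · rintro x hx ⟨hx₁, hx₂⟩
      rw [a.support]
      refine ⟨?_, hx₂⟩
      have hdet : (N.map (a.value θ x)).det ≠ 0 := by
        rw [← hδ]
        exact (Scheme.evaluation_ne_zero_iff_mem_basicOpen _ x (U := ⊤) trivial δ).2 hx
      have hzero : (N.map (a.value θ x)).mulVec (fun j => a.value θ x (MvPolynomial.X j)) = 0 := by
        ext i
        have h₁ := a.value_eq_zero_of_mem_map θ hθ hx₂ (hr i)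
        have h₂ : a.value θ x (dehomogenize (s.s i)) = 0 := hx₁ i
        rw [map_sub, map_sub, h₂, map_sum] at h₁
        have h₃ : (N.map (a.value θ x)).mulVec (fun j => a.value θ x (MvPolynomial.X j)) i =
            a.value θ x (MvPolynomial.X i) +
              ∑ j, a.value θ x (m i j * MvPolynomial.X j) := by
          simp [N, Matrix.mulVec, dotProduct, Matrix.one_apply,
            add_mul, Finset.sum_add_distrib]
        rw [h₃, Pi.zero_apply]
        linear_combination -h₁
      have := Matrix.eq_zero_of_mulVec_eq_zero hdet hzero
      intro i
      have hi := congrFun this i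
      simpa [value, VanishesAt] using hi
    · refine (Scheme.evaluation_ne_zero_iff_mem_basicOpen _ v (U := ⊤) trivial δ).1 ?_
      have h₁ : N.map (a.value θ v) = 1 := by
        ext i j
        have := a.value_eq_zero_of_mem_ideal θ hθ hvZ (hm i j)
        simp [N, Matrix.one_apply, this, apply_ite]
      change a.V.Γevaluation v δ ≠ 0
      rw [hδ, h₁, Matrix.det_one]
      exact one_ne_zero
  · have hcl : IsClosed {x | (∀ i, VanishesAt (a.twistφ θ s i) x) ∧ a.g x ∈ Y} := by
      have h₁ : {x | (∀ i, VanishesAt (a.twistφ θ s i) x) ∧ a.g x ∈ Y} =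
          (⋂ i, ((a.V.basicOpen (a.twistφ θ s i) : Set a.V)ᶜ)) ∩ a.g ⁻¹' Y := by
        ext x
        simp [vanishesAt_iff]
      rw [h₁]
      exact (isClosed_iInter fun i => (a.V.basicOpen _).isOpen.isClosed_compl).inter
        (Y.isClosed.preimage a.g.continuous)
    exact ⟨_, fun x hx hx' => absurd hx' hx, hcl.isOpen_compl, fun h => hvZ (hv h)⟩

/-- The open subscheme of `V` on which `(ζ ∘ (φ, g), g)⁻¹(0 × Y) = Z`. -/
def twistOpen (a : ExplicitCorr n S X Y) (θ : A →+* Γ(a.V, ⊤))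
    (hθ : a.Compatible θ J) (s : AdmissibleSection J n d) : a.V.Opens :=
  ⟨a.twistSet θ s, a.isOpen_twistSet θ hθ s⟩

/-- The explicit correspondence `(Z, V', ζ ∘ (φ, g), g)`, where `V' ⊆ V` is the open neighbourhood
of `Z` obtained by removing the points of `(ζ ∘ (φ, g), g)⁻¹(0 × Y)` outside `Z`. -/
def twist (a : ExplicitCorr n S X Y) (θ : A →+* Γ(a.V, ⊤))
    (hθ : a.Compatible θ J) (s : AdmissibleSection J n d) : ExplicitCorr n S X Y where
  Z := a.Z
  V := a.twistOpen θ hθ s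
  e := (a.twistOpen θ hθ s).ι ≫ a.e
  φ := fun i => (a.twistOpen θ hθ s).ι.appTop (a.twistφ θ s i)
  g := (a.twistOpen θ hθ s).ι ≫ a.g
  g_over := by simp [a.g_over]
  finite := a.finite
  nhd := by
    have := a.nhd.etale
    refine ⟨inferInstance, ?_⟩
    obtain ⟨c, hc⟩ := a.nhd.isPullback
    have hr : Set.range c ⊆ Set.range (a.twistOpen θ hθ s).ι := by
      rintro _ ⟨z, rfl⟩
      rw [Scheme.Opens.range_ι]
      intro _
      rw [← Scheme.Hom.comp_apply, hc.w, Category.id_comp]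
      have : redι a.Z z ∈ Set.range (redι a.Z) := ⟨z, rfl⟩
      rwa [Scheme.IdealSheafData.range_subschemeι,
        Scheme.IdealSheafData.coe_support_vanishingIdeal] at this
    have hl := IsOpenImmersion.lift_fac (a.twistOpen θ hθ s).ι c hr
    refine ⟨IsOpenImmersion.lift (a.twistOpen θ hθ s).ι c hr, ⟨⟨?_⟩, ⟨?_⟩⟩⟩
    · rw [reassoc_of% hl, hc.w]
    · refine PullbackCone.IsLimit.mk _ (fun t => t.snd) (fun t => ?_) (fun t => ?_) (fun t m _ h => ?_)
      · rw [← cancel_mono (a.twistOpen θ hθ s).ι, Category.assoc, hl]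
        have ht : (t.fst ≫ (a.twistOpen θ hθ s).ι) ≫ a.e = t.snd ≫ redι a.Z := by
          rw [Category.assoc]; exact t.condition
        have h₁ := hc.lift_fst _ _ ht
        have h₂ := hc.lift_snd _ _ ht
        rw [Category.comp_id] at h₂
        rw [← h₁, h₂]
      · exact Category.comp_id _
      · rw [← h, Category.comp_id]
  support := by
    intro v
    simp only [vanishesAt_appTop, Scheme.Hom.comp_apply]
    refine ⟨fun h => ⟨a.vanishesAt_twistφ θ hθ s h, ((a.support _).1 h).2⟩, fun h => ?_⟩
    exact v.2 h

lemma twist_refines {c a : ExplicitCorr n S X Y} (hZ : c.Z = a.Z) (w : c.V ⟶ a.V)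
    (he : w ≫ a.e = c.e) (hφ : ∀ i, w.appTop (a.φ i) = c.φ i) (hg : w ≫ a.g = c.g)
    (θ : A →+* Γ(a.V, ⊤)) (hθ : a.Compatible θ J)
    (θ' : A →+* Γ(c.V, ⊤)) (hθ' : c.Compatible θ' J) (hw : w.appTop.hom.comp θ = θ')
    (s : AdmissibleSection J n d) :
    (c.twist θ' hθ' s).Refines (a.twist θ hθ s) := by
  have htw : ∀ i, w.appTop (a.twistφ θ s i) = c.twistφ θ' s i := by
    intro i
    subst hw
    have : c.φ = fun j => w.appTop (a.φ j) := funext fun j => (hφ j).symm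
    unfold twistφ
    rw [this]
    exact MvPolynomial.hom_eval₂ _ θ w.appTop.hom a.φ
  have hr : Set.range ((c.twistOpen θ' hθ' s).ι ≫ w) ⊆ Set.range (a.twistOpen θ hθ s).ι := by
    rintro _ ⟨v, rfl⟩
    rw [Scheme.Opens.range_ι]
    rintro ⟨h₁, h₂⟩
    have he' : a.e (w v.1) = c.e v.1 := by rw [← Scheme.Hom.comp_apply, he]
    have hg' : a.g (w v.1) = c.g v.1 := by rw [← Scheme.Hom.comp_apply, hg]
    change a.e (w v.1) ∈ a.Z
    rw [he', ← hZ]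
    refine v.2 ⟨fun i => ?_, ?_⟩
    · rw [← htw, vanishesAt_appTop]
      exact h₁ i
    · rw [← hg']
      exact h₂
  obtain ⟨L, hl⟩ : ∃ L, L ≫ (a.twistOpen θ hθ s).ι = (c.twistOpen θ' hθ' s).ι ≫ w :=
    ⟨_, IsOpenImmersion.lift_fac (a.twistOpen θ hθ s).ι _ hr⟩
  refine ⟨hZ, L, ?_, ?_, ?_⟩
  · simp only [twist]
    rw [reassoc_of% hl, he]
  · intro i
    simp only [twist]
    rw [← htw]
    exact appTop_congr hl _
  · simp only [twist]
    rw [reassoc_of% hl, hg]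

end ExplicitCorr

/-- The image of a closed immersion, as a closed subset. -/
def closedImage {T X : Scheme.{u}} (i : T ⟶ X) [IsClosedImmersion i] : Closeds X :=
  ⟨Set.range i, i.isClosedEmbedding.isClosed_range⟩

/-- The ideal of regular functions on `X` which vanish on the closed subscheme `i : T ⟶ X`. -/
abbrev idealOf {T X : Scheme.{u}} (i : T ⟶ X) : Ideal Γ(X, ⊤) := RingHom.ker i.appTop.hom

section Action

variable {n d : ℕ} {S X : Over B} {Y : Scheme.{u}} (i : Y ⟶ X.left) [IsClosedImmersion i]

lemma ExplicitCorr.compatible_g (a : ExplicitCorr n S X (closedImage i)) :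
    a.Compatible a.g.appTop.hom (idealOf i) := by
  rintro v ⟨y, hy⟩ j hj
  change VanishesAt (a.g.appTop j) v
  rw [vanishesAt_appTop, ← hy, ← vanishesAt_appTop]
  have : i.appTop j = 0 := hj
  rw [this]
  exact map_zero (Y.Γevaluation y).hom

/-- The framed correspondence `α^s`, the class of `(Z, V, ζ ∘ (φ, g), g)`, for a framed
correspondence `α` from `S` to `(X, X - Y)` and sections `s` over `ℙⁿ × X`. -/
def Fr.twist (s : AdmissibleSection (idealOf i) n d) :
    Fr n S X (closedImage i) → Fr n S X (closedImage i) :=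
  Quot.map (fun a => a.twist a.g.appTop.hom (a.compatible_g i) s)
    fun _ _ ⟨c, ⟨hZ, w, he, hφ, hg⟩, ⟨hZ', w', he', hφ', hg'⟩⟩ =>
      ⟨c.twist c.g.appTop.hom (c.compatible_g i) s,
        ExplicitCorr.twist_refines hZ w he hφ hg _ _ _ _ (by rw [← hg, Scheme.Hom.comp_appTop]; rfl) s,
        ExplicitCorr.twist_refines hZ' w' he' hφ' hg' _ _ _ _ (by rw [← hg', Scheme.Hom.comp_appTop]; rfl) s⟩

/-- The ring homomorphism `Γ(X)[λ] →+* Γ(V)` defined by the morphism `(t, g) : V ⟶ 𝔸¹ × X`, where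
`t` is a regular function on `S`. -/
def ExplicitCorr.evalFamily {Y : Closeds X.left} (a : ExplicitCorr n S X Y) (t : Γ(S.left, ⊤)) :
    Polynomial Γ(X.left, ⊤) →+* Γ(a.V, ⊤) :=
  Polynomial.eval₂RingHom a.g.appTop.hom ((a.e ≫ Aff.pr n S.left).appTop t)

lemma ExplicitCorr.compatible_evalFamily (a : ExplicitCorr n S X (closedImage i))
    (t : Γ(S.left, ⊤)) :
    a.Compatible (a.evalFamily t) ((idealOf i).map Polynomial.C) := by
  intro v hv p hp
  have hle : (idealOf i).map Polynomial.C ≤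
      RingHom.ker ((a.V.Γevaluation v).hom.comp (a.evalFamily t)) := by
    rw [Ideal.map_le_iff_le_comap]
    intro j hj
    have h := a.compatible_g i v hv j hj
    simpa [ExplicitCorr.evalFamily, VanishesAt, RingHom.mem_ker] using h
  exact hle hp

lemma ExplicitCorr.evalFamily_comp {Y : Closeds X.left} {c a : ExplicitCorr n S X Y}
    (w : c.V ⟶ a.V) (he : w ≫ a.e = c.e) (hg : w ≫ a.g = c.g) (t : Γ(S.left, ⊤)) :
    w.appTop.hom.comp (a.evalFamily t) = c.evalFamily t := by
  refine Polynomial.ringHom_ext (fun x => ?_) ?_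
  · simp only [ExplicitCorr.evalFamily, RingHom.comp_apply, Polynomial.coe_eval₂RingHom,
      Polynomial.eval₂_C]
    rw [← hg, Scheme.Hom.comp_appTop]
    rfl
  · simp only [ExplicitCorr.evalFamily, RingHom.comp_apply, Polynomial.coe_eval₂RingHom,
      Polynomial.eval₂_X]
    rw [← he, Category.assoc, Scheme.Hom.comp_appTop w]
    rfl

/-- The framed correspondence `α^s` for a family `s` of sections over `𝔸¹ × ℙⁿ × X`, where `S` maps
to the parameter space `𝔸¹` by the regular function `t`. -/
def Fr.twistFamily (t : Γ(S.left, ⊤)) (s : AdmissibleSection ((idealOf i).map Polynomial.C) n d) :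
    Fr n S X (closedImage i) → Fr n S X (closedImage i) :=
  Quot.map (fun a => a.twist (a.evalFamily t) (a.compatible_evalFamily i t) s)
    fun _ _ ⟨c, ⟨hZ, w, he, hφ, hg⟩, ⟨hZ', w', he', hφ', hg'⟩⟩ =>
      ⟨c.twist (c.evalFamily t) (c.compatible_evalFamily i t) s,
        ExplicitCorr.twist_refines hZ w he hφ hg _ _ _ _ (ExplicitCorr.evalFamily_comp w he hg t) s,
        ExplicitCorr.twist_refines hZ' w' he' hφ' hg' _ _ _ _ (ExplicitCorr.evalFamily_comp w' he' hg' t) s⟩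

end Action

/-! ### The cylinder `S × 𝔸¹` and linear homotopies -/

/-- The `B`-scheme `S × 𝔸¹`. -/
def cylinder (S : Over B) : Over B := Over.mk (Aff.pr 1 S.left ≫ S.hom)

/-- The projection `S × 𝔸¹ ⟶ S`. -/
def cylinderPr (S : Over B) : cylinder S ⟶ S := Over.homMk (Aff.pr 1 S.left) rfl

/-- The coordinate function `λ` on `S × 𝔸¹`. -/
def cylinderCoord (S : Over B) : Γ((cylinder S).left, ⊤) := AffineSpace.coord S.left ⟨0⟩

/-- The linear homotopy `α^{λ s + (1 - λ) x}` over `S × 𝔸¹`. -/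
def Fr.linearHomotopy {n d : ℕ} {S X : Over B} {Y : Scheme.{u}} (i : Y ⟶ X.left)
    [IsClosedImmersion i] (s : AdmissibleSection (idealOf i) n d) (hd : 0 < d)
    (α : Fr n S X (closedImage i)) : Fr n (cylinder S) X (closedImage i) :=
  (α.baseChange (cylinderPr S)).twistFamily i (cylinderCoord S) (s.linearHomotopy hd)

/-- The `B`-scheme `S` is smooth, separated and of finite type. -/
structure IsSm (S : Over B) : Prop where
  smooth : Smooth S.hom
  separated : IsSeparated S.hom
  quasiCompact : QuasiCompact S.hom

end FramedCorrespondence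

end

open FramedCorrespondence

/-! Let `y` generate the ideal of `Y`, and perturb `x_i` by `∑ t_{i,l,e} w_l^{e+2}` with `e < r`,
where `w` runs through the `x`'s and the `y`'s and the `t`'s are constants in `k`. The exponents are
at least 2, so the section is admissible. Pulled back to `V`, the framing becomes `φ_i + c ∑
t_{i,l,e} f_l^{e+2}`, where `f = (φ, g^*y)` has zero locus exactly `Z`. Here `c = 1` in (a); in (b)
`c = λ`, because `λs + (1-λ)x = x + λ(s - x)`.

Quasi-finiteness is an open condition and the neighbourhood may be shrunk, so it suffices that each
point of `Z` is isolated in its fibre over the base, within the zero locus of the new framing. Where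
`c = 0`, the function `c`, which comes from the base, vanishes on the whole fibre, so the new zero
locus there is that of `φ`. In (b) it is quasi-finite by hypothesis; in (a) there are no such
points.

Where `c ≠ 0`, a dimension count with indeterminate `t` applies (`le_card_of_generic_relation`). If
a point of `Z` is not isolated, then, `Z` being quasi-finite over the base, some `f_j` is
transcendental over the residue field of the base point along a positive-dimensional piece of the
fibre. Take `r` independent points on that piece. Each has only `n` coordinates up to algebraic
dependence, because `V` is étale over affine space. Yet the equations at these points form
Vandermonde systems that determine the `n r` coefficients with index `j`. Hence `n r + r`
independent quantities depend on `n r + D`, where `D` bounds the number of generators of the base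
ring, and `r ≤ D`. For `r > D` the generic perturbation is therefore quasi-finite along `Z` where `c
≠ 0`. This spreads out to a nonempty open set of coefficients (`exists_generic_isolated`), which has
a `k`-point since `k` is infinite. -/

/-! ### Field theory: the transcendence degree count. -/

/-- These embeddings play the role of independent generic points of a variety with function field
`κ`. Extend `τ` to a transcendence basis, send it to a separate set of variables for each index, and
extend to `κ` inside an algebraic closure. -/
theorem Transcendental.exists_algHoms_algebraicIndependent {L κ : Type u} [Field L] [Field κ]
    [Algebra L κ] {τ : κ} (hτ : Transcendental L τ) (ι : Type) :
    ∃ (Ω : Type u) (_ : Field Ω) (_ : Algebra L Ω) (σ : ι → κ →ₐ[L] Ω),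
      AlgebraicIndependent L (fun a => σ a τ) := by
  have hind : AlgebraicIndepOn L id ({τ} : Set κ) :=
    (algebraicIndependent_unique_type_iff (ι := ({τ} : Set κ))).2 hτ
  obtain ⟨s, hs, hb⟩ := exists_isTranscendenceBasis_superset hind
  have hτs : τ ∈ s := hs rfl
  let P := MvPolynomial (ι × s) L
  let Ω := AlgebraicClosure (FractionRing P)
  have hP : Function.Injective (IsScalarTower.toAlgHom L P Ω) := by
    change Function.Injective (algebraMap P Ω)
    rw [IsScalarTower.algebraMap_eq P (FractionRing P) Ω, RingHom.coe_comp]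
    exact (algebraMap (FractionRing P) Ω).injective.comp (IsFractionRing.injective P _)
  let emb (a : ι) : Algebra.adjoin L (Set.range ((↑) : s → κ)) →ₐ[L] Ω :=
    ((IsScalarTower.toAlgHom L P Ω).comp (MvPolynomial.rename (fun b : s => (a, b)))).comp
      hb.1.aevalEquiv.symm.toAlgHom
  have hemb (a : ι) : Function.Injective (emb a) :=
    (hP.comp (MvPolynomial.rename_injective _ (Prod.mk_right_injective a))).comp
      hb.1.aevalEquiv.symm.injective
  have key (a : ι) : ∃ σ : κ →ₐ[L] Ω, σ τ = IsScalarTower.toAlgHom L P Ω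
      (MvPolynomial.X (a, ⟨τ, hτs⟩)) := by
    let : Algebra (Algebra.adjoin L (Set.range ((↑) : s → κ))) Ω := (emb a).toRingHom.toAlgebra
    have : IsScalarTower L (Algebra.adjoin L (Set.range ((↑) : s → κ))) Ω :=
      .of_algebraMap_eq fun x => ((emb a).commutes x).symm
    have : FaithfulSMul (Algebra.adjoin L (Set.range ((↑) : s → κ))) Ω :=
      (faithfulSMul_iff_algebraMap_injective _ _).2 (hemb a)
    have := hb.isAlgebraic
    refine ⟨(IsAlgClosed.lift (R := Algebra.adjoin L (Set.range ((↑) : s → κ))) (S := κ)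
      (M := Ω)).restrictScalars L, ?_⟩
    have h₁ : τ = algebraMap (Algebra.adjoin L (Set.range ((↑) : s → κ))) κ
        (hb.1.aevalEquiv (MvPolynomial.X ⟨τ, hτs⟩)) := by
      rw [hb.1.algebraMap_aevalEquiv, MvPolynomial.aeval_X]
    conv_lhs => rw [h₁]
    rw [AlgHom.restrictScalars_apply, AlgHom.commutes]
    change IsScalarTower.toAlgHom L P Ω (MvPolynomial.rename _
      (hb.1.aevalEquiv.symm (hb.1.aevalEquiv (MvPolynomial.X ⟨τ, hτs⟩)))) = _
    rw [AlgEquiv.symm_apply_apply, MvPolynomial.rename_X]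
  choose σ hσ using key
  refine ⟨Ω, AlgebraicClosure.instField _, inferInstance, σ, ?_⟩
  have h := ((MvPolynomial.algebraicIndependent_X (ι × s) L).map'
    (f := IsScalarTower.toAlgHom L P Ω) hP).comp
    (fun a : ι => (a, (⟨τ, hτs⟩ : s))) (Prod.mk_left_injective _)
  rwa [show (fun a => σ a τ) = _ from funext hσ]

/-- This is monotonicity of rank in the matroid of algebraic independence. -/
theorem AlgebraicIndependent.card_le_of_isAlgebraic_adjoin {k Ω : Type*} [Field k] [Field Ω]
    [Algebra k Ω] {ι : Type*} [Fintype ι] {y : ι → Ω} (hy : AlgebraicIndependent k y) {s : Set Ω}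
    {m : ℕ} (hm : s.encard ≤ m) (h : ∀ i, IsAlgebraic (Algebra.adjoin k s) (y i)) :
    Fintype.card ι ≤ m := by
  let M := AlgebraicIndependent.matroid k Ω
  have h₁ : M.Indep (Set.range y) := AlgebraicIndependent.matroid_indep_iff.2 hy.coe_range
  have h₂ : Set.range y ⊆ M.closure s := by
    rw [AlgebraicIndependent.matroid_closure_eq]
    rintro _ ⟨i, rfl⟩
    exact h i
  have h₃ : (Set.range y).encard ≤ m := by
    rw [← h₁.eRk_eq_encard]
    exact ((M.eRk_mono h₂).trans (M.eRk_closure_eq s).le).trans ((M.eRk_le_encard s).trans hm)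
  have h₄ : (Set.range y).encard = Fintype.card ι := by
    rw [← Set.image_univ, hy.injective.encard_image, Set.encard_univ, ENat.card_eq_coe_fintype_card]
  rw [h₄] at h₃
  exact_mod_cast h₃

theorem mem_of_vandermonde {Ω : Type*} [Field Ω] (E : Subfield Ω) {r : ℕ} {t τ : Fin r → Ω}
    (hτ : ∀ a, τ a ∈ E) (hinj : Function.Injective τ) (h₀ : ∀ a, τ a ≠ 0)
    (h : ∀ a, ∑ e : Fin r, t e * τ a ^ ((e : ℕ) + 2) ∈ E) (e : Fin r) : t e ∈ E := by
  let τ' : Fin r → E := fun a => ⟨τ a, hτ a⟩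
  -- Dividing the equation at `a` by `τ a ^ 2` leaves a genuine Vandermonde system, invertible over
  -- `E` since the `τ a` are distinct.
  let w : Fin r → E := fun a => ⟨_, E.mul_mem (E.inv_mem (E.pow_mem (hτ a) 2)) (h a)⟩
  let M := Matrix.vandermonde τ'
  have hM : IsUnit M.det := by
    rw [isUnit_iff_ne_zero, Matrix.det_vandermonde_ne_zero_iff]
    exact fun a b hab => hinj (congrArg Subtype.val hab)
  have h₁ : (M.map E.subtype).mulVec t = E.subtype ∘ w := by
    ext a
    simp only [Matrix.mulVec, dotProduct, M, Matrix.map_apply, Matrix.vandermonde_apply, w, τ',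
      Function.comp_apply, Subfield.subtype_apply, map_pow, Finset.mul_sum]
    refine Finset.sum_congr rfl fun e _ => ?_
    have := h₀ a
    field_simp
    ring
  have h₂ : t = E.subtype ∘ (M⁻¹.mulVec w) := by
    have h₃ : M⁻¹.map E.subtype * M.map E.subtype = 1 := by
      rw [← Matrix.map_mul, Matrix.nonsing_inv_mul M hM]
      simp
    calc t = (M⁻¹.map E.subtype * M.map E.subtype).mulVec t := by rw [h₃, Matrix.one_mulVec]
      _ = (M⁻¹.map E.subtype).mulVec (E.subtype ∘ w) := by rw [← Matrix.mulVec_mulVec, h₁]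
      _ = _ := by
        ext a
        exact (RingHom.map_mulVec E.subtype M⁻¹ w a).symm
  rw [h₂]
  exact (M⁻¹.mulVec w e).2

/-- The dimension count. Copying the relations under `r` independent embeddings costs `r n` new
coordinates, but makes the `n r` coefficients with index `j₀` redundant. The surplus of `r`
independent values of `f j₀` can only be paid for by `G`. -/
theorem le_card_of_generic_relation {k L κ : Type u} [Field k] [Field L] [Field κ] [Algebra k L]
    [Algebra k κ] [Algebra L κ] [IsScalarTower k L κ] {n r D : ℕ} {ι : Type} [Fintype ι]
    {t : Fin n × ι × Fin r → L} (ht : AlgebraicIndependent k t) {G : Set L} (hG : G.encard ≤ D)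
    {x φ : Fin n → κ} {f : ι → κ} {c : κ} (hc : c ≠ 0)
    (hcG : IsAlgebraic (Algebra.adjoin k (algebraMap L κ '' G ∪ Set.range x)) c)
    (hφ : ∀ i, IsAlgebraic (Algebra.adjoin k (algebraMap L κ '' G ∪ Set.range x)) (φ i))
    (hf : ∀ j, IsAlgebraic (Algebra.adjoin k (algebraMap L κ '' G ∪ Set.range x)) (f j))
    {j₀ : ι} (hτ : Transcendental L (f j₀))
    (hrel : ∀ i, φ i + c * ∑ p : ι × Fin r,
      algebraMap L κ (t (i, p)) * f p.1 ^ ((p.2 : ℕ) + 2) = 0) : r ≤ D := by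
  classical
  obtain ⟨Ω, _, _, σ, hσ⟩ := hτ.exists_algHoms_algebraicIndependent (Fin r)
  let : Algebra k Ω := ((algebraMap L Ω).comp (algebraMap k L)).toAlgebra
  have : IsScalarTower k L Ω := .of_algebraMap_eq fun _ => rfl
  have hind := ht.sumElim_comp hσ
  -- Generators of the base, coordinates of the `r` points, and all coefficients except those with
  -- index `j₀`.
  let Gs : Set Ω := algebraMap L Ω '' G ∪ Set.range (fun p : Fin r × Fin n => σ p.1 (x p.2)) ∪
    Set.range (fun p : {p : Fin n × ι × Fin r // ¬ p.2.1 = j₀} => algebraMap L Ω (t p))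
  let E := algebraicClosure (IntermediateField.adjoin k Gs) Ω
  have hE : ∀ z, z ∈ E ↔ IsAlgebraic (Algebra.adjoin k Gs) z := fun z =>
    mem_algebraicClosure_iff.trans IntermediateField.isAlgebraic_adjoin_iff
  have hGs : ∀ z ∈ Gs, z ∈ E := fun z hz => (hE z).2 <|
    isAlgebraic_algebraMap (A := Ω) (⟨z, Algebra.subset_adjoin hz⟩ : Algebra.adjoin k Gs)
  have hmap : ∀ a, ∀ z, IsAlgebraic (Algebra.adjoin k (algebraMap L κ '' G ∪ Set.range x)) z →
      σ a z ∈ E := by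
    intro a z hz
    have hle : Algebra.adjoin k (algebraMap L κ '' G ∪ Set.range x) ≤
        (Algebra.adjoin k Gs).comap ((σ a).restrictScalars k) := by
      refine Algebra.adjoin_le ?_
      rintro _ (⟨g, hg, rfl⟩ | ⟨i, rfl⟩)
      · refine Algebra.subset_adjoin (.inl (.inl ⟨g, hg, ?_⟩))
        simp
      · exact Algebra.subset_adjoin (.inl (.inr ⟨(a, i), rfl⟩))
    rw [hE]
    refine hz.ringHom_of_comp_eq
      (((σ a).toRingHom.comp (Algebra.adjoin k (algebraMap L κ '' G ∪ Set.range x)).val.toRingHom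
        ).codRestrict (Algebra.adjoin k Gs) fun y => hle y.2) (σ a) ?_ ?_
    · intro y y' hyy'
      exact Subtype.ext ((σ a).injective (congrArg Subtype.val hyy'))
    · rfl
  have ht' : ∀ p, algebraMap L Ω (t p) ∈ E := by
    rintro ⟨i, j, e⟩
    by_cases hj : j = j₀
    swap
    · exact hGs _ (.inr ⟨⟨(i, j, e), hj⟩, rfl⟩)
    subst hj
    -- For fixed `i`, the `r` conjugates of the `i`-th relation are linear equations for the `r`
    -- missing coefficients; dividing by `σ a c` and moving the other terms across keeps everything
    -- in `E`.
    refine mem_of_vandermonde E.toSubfield (t := fun e => algebraMap L Ω (t (i, j, e)))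
      (τ := fun a => σ a (f j)) (fun a => hmap a _ (hf j)) hσ.injective
      (fun a => hσ.ne_zero a) (fun a => ?_) e
    have h₁ := congrArg (σ a) (hrel i)
    simp only [map_add, map_mul, map_sum, map_pow, map_zero, AlgHom.commutes,
      Fintype.sum_prod_type] at h₁
    rw [← Finset.add_sum_erase _ _ (Finset.mem_univ j)] at h₁
    have hc' : σ a c ≠ 0 := (map_ne_zero _).2 hc
    have h₂ : ∑ e : Fin r, algebraMap L Ω (t (i, j, e)) * σ a (f j) ^ ((e : ℕ) + 2) =
        -((σ a c)⁻¹ * σ a (φ i)) - ∑ j' ∈ Finset.univ.erase j, ∑ e : Fin r,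
          algebraMap L Ω (t (i, j', e)) * σ a (f j') ^ ((e : ℕ) + 2) := by
      field_simp
      linear_combination h₁
    rw [h₂]
    refine E.sub_mem (E.neg_mem (E.mul_mem (E.inv_mem (hmap a _ hcG)) (hmap a _ (hφ i))))
      (E.sum_mem fun j' hj' => E.sum_mem fun e' _ => E.mul_mem (hGs _ (.inr
        ⟨⟨(i, j', e'), (Finset.mem_erase.1 hj').1⟩, rfl⟩)) (pow_mem (hmap a _ (hf j')) _))
  have hcard : Gs.encard ≤ (D + r * n +
      Fintype.card {p : Fin n × ι × Fin r // ¬ p.2.1 = j₀} : ℕ) := by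
    refine (Set.encard_union_le _ _).trans ?_
    push_cast
    refine add_le_add ((Set.encard_union_le _ _).trans
      (add_le_add ((Set.encard_image_le _ _).trans hG) ?_)) ?_
    · rw [← Set.image_univ]
      refine (Set.encard_image_le _ _).trans ?_
      simp [Set.encard_univ]
    · rw [← Set.image_univ]
      refine (Set.encard_image_le _ _).trans ?_
      rw [Set.encard_univ, ENat.card_eq_coe_fintype_card]
  have hle := hind.card_le_of_isAlgebraic_adjoin hcard (by
    rintro (a | p)
    · exact (hE _).1 (hmap a _ (hf j₀))
    · exact (hE _).1 (ht' p))
  have h₁ := Fintype.card_congr (Equiv.sumCompl fun p : Fin n × ι × Fin r => p.2.1 = j₀)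
  have h₂ : Fintype.card {p : Fin n × ι × Fin r // p.2.1 = j₀} = n * r := by
    have h := Fintype.card_congr (α := {p : Fin n × ι × Fin r // p.2.1 = j₀}) (β := Fin n × Fin r)
      { toFun := fun p => (p.1.1, p.1.2.2)
        invFun := fun q => ⟨(q.1, j₀, q.2), rfl⟩
        left_inv := by rintro ⟨⟨i, j, e⟩, rfl⟩; rfl
        right_inv := fun _ => rfl }
    simpa using h
  rw [Fintype.card_sum, Fintype.card_fin] at hle
  rw [Fintype.card_sum, h₂] at h₁
  have := mul_comm n r
  omega

/-! ### Commutative algebra of quasi-finite primes. -/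

/-- The fibre ring is of finite type over a field, hence Noetherian and Jacobson; in its spectrum a
closed point stable under generalization is open. -/
theorem Algebra.QuasiFiniteAt.of_forall_eq {R S : Type*} [CommRing R] [CommRing S] [Algebra R S]
    [Algebra.FiniteType R S] (q : Ideal S) [hq : q.IsPrime]
    (h : ∀ q' : Ideal S, q'.IsPrime → q'.under R = q.under R → q' ≤ q ∨ q ≤ q' → q' = q) :
    Algebra.QuasiFiniteAt R q := by
  let x : PrimeSpectrum S := ⟨q, hq⟩
  let e := PrimeSpectrum.preimageHomeomorphFiber R S (x.comap (algebraMap R S))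
  let y : PrimeSpectrum.comap (algebraMap R S) ⁻¹' {x.comap (algebraMap R S)} := ⟨x, rfl⟩
  have hy : ∀ z, z ⤳ y ∨ y ⤳ z → z = y := by
    rintro ⟨z, hz⟩ hzy
    refine Subtype.ext (PrimeSpectrum.ext ?_)
    rw [← Topology.IsInducing.subtypeVal.specializes_iff,
      ← Topology.IsInducing.subtypeVal.specializes_iff, ← PrimeSpectrum.le_iff_specializes,
      ← PrimeSpectrum.le_iff_specializes] at hzy
    exact h _ z.2 (congrArg PrimeSpectrum.asIdeal hz) hzy
  refine .of_isOpen_singleton_fiber x ?_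
  have : IsNoetherianRing ((x.comap (algebraMap R S)).asIdeal.Fiber S) :=
    Algebra.FiniteType.isNoetherianRing (x.comap (algebraMap R S)).asIdeal.ResidueField _
  have : IsJacobsonRing ((x.comap (algebraMap R S)).asIdeal.Fiber S) :=
    isJacobsonRing_of_finiteType (A := (x.comap (algebraMap R S)).asIdeal.ResidueField)
  change IsOpen {y}
  rw [← e.isOpen_image, Set.image_singleton]
  have htfae : IsOpen {e y} ↔ IsClosed {e y} ∧ StableUnderGeneralization {e y} :=
    (PrimeSpectrum.isOpen_singleton_tfae_of_isNoetherian_of_isJacobsonRing (e y)).out 0 2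
  refine htfae.2 ⟨?_, ?_⟩
  · rw [← Set.image_singleton, e.isClosed_image]
    refine isClosed_of_closure_subset fun z hz => hy z (.inr ?_)
    exact specializes_iff_mem_closure.2 hz
  · rintro _ z hz rfl
    have h₁ : e.symm z ⤳ y := by
      have := hz.map e.symm.continuous
      rwa [e.symm_apply_apply] at this
    rw [Set.mem_singleton_iff, ← hy _ (.inl h₁), e.apply_symm_apply]

/-- Openness of the quasi-finite locus, from Zariski's main theorem. -/
theorem Algebra.QuasiFiniteAt.exists_notMem_forall {R S : Type*} [CommRing R] [CommRing S]
    [Algebra R S] [Algebra.FiniteType R S] (q : Ideal S) [q.IsPrime] [Algebra.QuasiFiniteAt R q] :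
    ∃ r ∉ q, ∀ (q' : Ideal S) [q'.IsPrime], r ∉ q' → Algebra.QuasiFiniteAt R q' := by
  obtain ⟨r, hr, h⟩ := Algebra.zariskisMainProperty_iff.1
    (Algebra.ZariskisMainProperty.of_finiteType_of_weaklyQuasiFiniteAt (R := R) q)
  exact ⟨r, hr, fun q' _ hq' => Algebra.ZariskisMainProperty.quasiFiniteAt q'
    (Algebra.zariskisMainProperty_iff.2 ⟨r, hq', h⟩)⟩

/-- Quasi-finiteness at the primes of a closed set which avoid a multiplicative set spreads out
to a basic open subset defined by an element of that multiplicative set. -/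
theorem Algebra.QuasiFiniteAt.exists_mem_submonoid {R S : Type*} [CommRing R] [CommRing S]
    [Algebra R S] [Algebra.FiniteType R S] (I : Ideal S) (M : Submonoid S)
    (h : ∀ (q : Ideal S) [q.IsPrime], I ≤ q → Disjoint (q : Set S) M →
      Algebra.QuasiFiniteAt R q) :
    ∃ g ∈ M, ∀ (q : Ideal S) [q.IsPrime], I ≤ q → g ∉ q → Algebra.QuasiFiniteAt R q := by
  -- If `I` and `s` together generated an ideal disjoint from `M`, a prime containing it and
  -- avoiding `M` would be quasi-finite, and by openness would miss an element of `s`.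
  let s : Set S := {r | ∀ (q : Ideal S) [q.IsPrime], r ∉ q → Algebra.QuasiFiniteAt R q}
  by_cases hM : Disjoint ((I ⊔ Ideal.span s : Ideal S) : Set S) M
  · obtain ⟨q, hq, hle, hqM⟩ := Ideal.exists_le_prime_disjoint _ M hM
    have := h q (le_sup_left.trans hle) hqM
    obtain ⟨r, hr, hr'⟩ := exists_notMem_forall (R := R) q
    exact absurd (hle (Ideal.mem_sup_right (Ideal.subset_span hr'))) hr
  · obtain ⟨g, hg, hgM⟩ := Set.not_disjoint_iff.1 hM
    refine ⟨g, hgM, fun q _ hIq hgq => ?_⟩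
    by_contra hq
    refine hgq (sup_le hIq (Ideal.span_le.2 fun r hr => ?_) hg)
    by_contra hrq
    exact hq (hr q hrq)

/-- Inside a closed subset that is quasi-finite over the base, the fibres have no proper
specializations. -/
theorem Ideal.eq_of_le_of_quasiFinite_of_surjective {R A B : Type*} [CommRing R] [CommRing A]
    [CommRing B] [Algebra R A] [Algebra R B] [Algebra.QuasiFinite R B] (π : A →ₐ[R] B)
    (hπ : Function.Surjective π) {P Q : Ideal A} [P.IsPrime] [Q.IsPrime]
    (hP : RingHom.ker π ≤ P) (hPQ : P ≤ Q) (h : P.under R = Q.under R) : P = Q := by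
  have hcomap : ∀ I : Ideal A, RingHom.ker π ≤ I → (I.map π).comap π = I := fun I hI => by
    rw [Ideal.comap_map_of_surjective _ hπ, ← RingHom.ker_eq_comap_bot, sup_eq_left.2 hI]
  have hunder : ∀ I : Ideal A, RingHom.ker π ≤ I → (I.map π).under R = I.under R := fun I hI => by
    ext a
    rw [Ideal.mem_under, Ideal.mem_under, ← π.commutes, ← Ideal.mem_comap, hcomap I hI]
  have := Ideal.map_isPrime_of_surjective hπ hP
  have := Ideal.map_isPrime_of_surjective hπ (hP.trans hPQ)
  rw [← hcomap P hP, ← hcomap Q (hP.trans hPQ), Algebra.QuasiFinite.eq_of_le_of_under_eq (R := R)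
    (P.map π) (Q.map π) (Ideal.map_mono hPQ) (by rw [hunder P hP, hunder Q (hP.trans hPQ), h])]

/-- As `b ∈ Q`, the constant coefficient lies in `Q`, hence in `P`, since both primes contract to
the same prime of `A`. Subtract it, cancel `b ∉ P`, and repeat. Thus `b` is transcendental in the
residue field of `P` over that of the base. -/
theorem Ideal.algebraMap_coeff_mem_of_aeval_mem {A B : Type*} [CommRing A] [CommRing B]
    [Algebra A B] {P Q : Ideal B} [P.IsPrime] (hPQ : P ≤ Q) (h : P.under A = Q.under A) {b : B}
    (hb : b ∈ Q) (hb' : b ∉ P) (p : Polynomial A) (hp : Polynomial.aeval b p ∈ P) (m : ℕ) :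
    algebraMap A B (p.coeff m) ∈ P := by
  induction m generalizing p with
  | zero =>
    rw [← Ideal.mem_under, h, Ideal.mem_under]
    rw [← Polynomial.divX_mul_X_add p] at hp
    have := Q.sub_mem (hPQ hp) (Q.mul_mem_left (Polynomial.aeval b p.divX) hb)
    simpa using this
  | succ m ih =>
    rw [← Polynomial.coeff_divX]
    refine ih _ ?_
    have h₀ : algebraMap A B (p.coeff 0) ∈ P := by
      rw [← Ideal.mem_under, h, Ideal.mem_under]
      rw [← Polynomial.divX_mul_X_add p] at hp
      have := Q.sub_mem (hPQ hp) (Q.mul_mem_left (Polynomial.aeval b p.divX) hb)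
      simpa using this
    rw [← Polynomial.divX_mul_X_add p] at hp
    have h₁ : Polynomial.aeval b p.divX * b ∈ P := by
      have := P.sub_mem hp h₀
      simpa using this
    exact ((Ideal.IsPrime.mem_or_mem ‹_› h₁).resolve_right hb')

/-- The residue field at `ker h` is finite over the fraction field of the image of `A`. -/
theorem RingHom.QuasiFinite.isAlgebraic_range {A S K : Type*} [CommRing A] [CommRing S] [Field K]
    {χ : A →+* S} (hχ : χ.QuasiFinite) (h : S →+* K) (s : S) :
    IsAlgebraic (h.comp χ).range (h s) := by
  algebraize [χ]
  let P := RingHom.ker h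
  have hP : P.IsPrime := RingHom.ker_isPrime h
  let F := P.ResidueField
  let l : F →+* K := Ideal.ResidueField.lift P h le_rfl (by
    intro x hx
    exact isUnit_iff_ne_zero.2 hx)
  let A' := (algebraMap A F).range
  let : Algebra A A' := (algebraMap A F).rangeRestrict.toAlgebra
  have : IsScalarTower A A' F := .of_algebraMap_eq fun _ => rfl
  have : Algebra.QuasiFinite A' F := .of_restrictScalars A _ _
  have hinj : Function.Injective (algebraMap A' F) := Subtype.val_injective
  let : Algebra (FractionRing A') F := (IsFractionRing.lift hinj).toAlgebra
  have : IsScalarTower A' (FractionRing A') F := .of_algebraMap_eq fun x => by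
    exact (IsFractionRing.lift_algebraMap hinj x).symm
  have : Algebra.QuasiFinite (FractionRing A') F := .of_restrictScalars A' _ _
  have : Module.Finite (FractionRing A') F := .of_quasiFinite
  have h₁ : IsAlgebraic A' (algebraMap S F s) :=
    (IsFractionRing.isAlgebraic_iff A' (FractionRing A') F).2 (Algebra.IsAlgebraic.isAlgebraic _)
  have hl : ∀ s, l (algebraMap S F s) = h s := fun s => Ideal.ResidueField.lift_algebraMap ..
  rw [← hl]
  refine h₁.ringHom_of_comp_eq (((l.comp A'.subtype)).codRestrict (h.comp χ).range ?_) l ?_ rfl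
  · rintro ⟨_, a, rfl⟩
    refine ⟨a, ?_⟩
    change h (χ a) = l (algebraMap S F (χ a))
    rw [hl]
  · intro x y hxy
    exact Subtype.ext (l.injective (congrArg Subtype.val hxy))

/-! ### Perturbations with indeterminate coefficients, and their specialization. -/

section GenericPerturbation

attribute [local instance] MvPolynomial.algebraMvPolynomial

/-- The generic member of the family of functions `φ + c ∑ tₚ fⱼ ^ (e + 2)`, `p = (j, e)`, with
indeterminate coefficients `tₚ`. -/
noncomputable def genericPerturbation {S : Type*} [CommRing S] {n r : ℕ} {ι : Type*} [Fintype ι]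
    (φ : Fin n → S) (f : ι → S) (c : S) (i : Fin n) : MvPolynomial (Fin n × ι × Fin r) S :=
  MvPolynomial.C (φ i) + MvPolynomial.C c * ∑ p : ι × Fin r,
    MvPolynomial.X (i, p) * MvPolynomial.C (f p.1) ^ ((p.2 : ℕ) + 2)

/-- Applies the dimension count in the residue field of `P`. The condition `hk` says that `P` lies
over the generic point of the space of coefficients; `χ` gives the coordinates on which all of `S`
depends algebraically. -/
theorem le_card_of_genericPerturbation {k R S : Type u} [Field k] [CommRing R] [CommRing S]
    [Algebra k R] [Algebra R S] [Algebra k S] [IsScalarTower k R S] {n r : ℕ} {ι : Type}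
    [Fintype ι] {G : Finset R} (hG : Algebra.adjoin k (G : Set R) = ⊤)
    {χ : MvPolynomial (Fin n) R →+* S} (hχ : χ.QuasiFinite)
    (hχC : χ.comp MvPolynomial.C = algebraMap R S)
    {φ : Fin n → S} {f : ι → S} {c : S}
    {P Q : Ideal (MvPolynomial (Fin n × ι × Fin r) S)} [P.IsPrime] [Q.IsPrime] (hPQ : P ≤ Q)
    (h : P.under (MvPolynomial (Fin n × ι × Fin r) R) =
      Q.under (MvPolynomial (Fin n × ι × Fin r) R))
    (hP : ∀ i, genericPerturbation φ f c i ∈ P) {j : ι} (hjQ : MvPolynomial.C (f j) ∈ Q)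
    (hjP : MvPolynomial.C (f j) ∉ P) (hc : MvPolynomial.C c ∉ P)
    (hk : ∀ g : MvPolynomial (Fin n × ι × Fin r) k, MvPolynomial.map (algebraMap k S) g ∈ P → g = 0) :
    r ≤ G.card := by
  classical
  let σ := Fin n × ι × Fin r
  have : IsScalarTower k (MvPolynomial σ R) (MvPolynomial σ S) := .of_algebraMap_eq fun a => by
    change _ = MvPolynomial.map (algebraMap R S) (MvPolynomial.C (algebraMap k R a))
    rw [MvPolynomial.map_C, ← IsScalarTower.algebraMap_apply]
    rfl
  let κ := P.ResidueField
  let ρ : MvPolynomial σ S →ₐ[k] κ := IsScalarTower.toAlgHom k (MvPolynomial σ S) κ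
  have hρ : ∀ x, ρ x = 0 ↔ x ∈ P := fun x => Ideal.algebraMap_residueField_eq_zero
  let ρR : MvPolynomial σ R →ₐ[k] κ :=
    ρ.comp (IsScalarTower.toAlgHom k (MvPolynomial σ R) (MvPolynomial σ S))
  let L := IntermediateField.adjoin k (Set.range ρR)
  have hL : ∀ x, ρR x ∈ L := fun x => IntermediateField.subset_adjoin _ _ ⟨x, rfl⟩
  let t : σ → L := fun p => ⟨ρR (MvPolynomial.X p), hL _⟩
  let G' : Set L := (fun a : R => (⟨ρR (MvPolynomial.C a), hL _⟩ : L)) '' G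
  let x : Fin n → κ := fun i => ρ (MvPolynomial.C (χ (MvPolynomial.X i)))
  let A := Algebra.adjoin k (algebraMap L κ '' G' ∪ Set.range x)
  have hAR : ∀ a : R, ρR (MvPolynomial.C a) ∈ A := by
    have hle : Algebra.adjoin k (G : Set R) ≤
        A.comap (ρR.comp (IsScalarTower.toAlgHom k R (MvPolynomial σ R))) :=
      Algebra.adjoin_le fun a ha =>
        Algebra.subset_adjoin (.inl ⟨_, ⟨a, ha, rfl⟩, rfl⟩)
    intro a
    exact hle (hG ▸ Algebra.mem_top)
  have hA : ∀ y : MvPolynomial (Fin n) R, ρ (MvPolynomial.C (χ y)) ∈ A := by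
    intro y
    induction y using MvPolynomial.induction_on with
    | C a =>
      have h₁ : χ (MvPolynomial.C a) = algebraMap R S a := DFunLike.congr_fun hχC a
      rw [h₁]
      have := hAR a
      simpa [ρR] using this
    | add p q hp hq =>
      rw [map_add, map_add, map_add]
      exact A.add_mem hp hq
    | mul_X p i hp =>
      rw [map_mul, map_mul, map_mul]
      exact A.mul_mem hp (Algebra.subset_adjoin (.inr ⟨i, rfl⟩))
  have halg : ∀ s : S, IsAlgebraic A (ρ (MvPolynomial.C s)) := by
    intro s
    have := hχ.isAlgebraic_range (ρ.toRingHom.comp MvPolynomial.C) s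
    refine this.ringHom_of_comp_eq (Subring.inclusion (T := A.toSubring) ?_) (RingHom.id κ)
      (Subring.inclusion_injective _) rfl
    rintro _ ⟨y, rfl⟩
    exact hA y
  have ht : AlgebraicIndependent k t := by
    rw [algebraicIndependent_iff]
    intro p hp
    refine hk p ((hρ _).1 ?_)
    have h₁ := congrArg (algebraMap L κ) hp
    rw [map_zero, ← MvPolynomial.aeval_algebraMap_apply] at h₁
    rw [← h₁]
    clear h₁ hp
    induction p using MvPolynomial.induction_on with
    | C a =>
      rw [MvPolynomial.map_C, MvPolynomial.aeval_C]
      exact ρ.commutes a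
    | add p q hp hq => rw [map_add, map_add, map_add, hp, hq]
    | mul_X p i hp =>
      rw [map_mul, map_mul, map_mul, hp, MvPolynomial.map_X, MvPolynomial.aeval_X]
      simp [t, ρR]
  -- An algebraic relation over `L` can be taken with coefficients in the image of `R[t]`; the jump
  -- from `P` to `Q`, where `f j` starts to vanish, kills them all.
  have hτ : Transcendental L (ρ (MvPolynomial.C (f j))) := by
    intro halg
    rw [IntermediateField.isAlgebraic_adjoin_iff, ← AlgHom.coe_range, Algebra.adjoin_eq] at halg
    obtain ⟨p, hp, hp'⟩ := halg
    obtain ⟨q, rfl⟩ := Polynomial.map_surjective ρR.rangeRestrict.toRingHom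
      ρR.rangeRestrict_surjective p
    have h₁ : Polynomial.aeval (MvPolynomial.C (f j)) q ∈ P := by
      rw [← hρ, ← hp', Polynomial.aeval_def, Polynomial.aeval_def, Polynomial.eval₂_map]
      exact Polynomial.hom_eval₂ _ _ ρ.toRingHom _
    refine hp (Polynomial.ext fun m => ?_)
    rw [Polynomial.coeff_map, Polynomial.coeff_zero]
    exact Subtype.ext ((hρ _).2 (Ideal.algebraMap_coeff_mem_of_aeval_mem hPQ h hjQ hjP q h₁ m))
  refine (le_card_of_generic_relation ht (G := G') (D := G.card) ?_ (c := ρ (MvPolynomial.C c))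
    (x := x) (φ := fun i => ρ (MvPolynomial.C (φ i))) (f := fun i => ρ (MvPolynomial.C (f i)))
    ?_ (halg c) (fun i => halg _) (fun i => halg _) hτ ?_)
  · exact (Set.encard_image_le _ _).trans (by simp)
  · rwa [Ne, hρ]
  · intro i
    have := (hρ _).2 (hP i)
    simpa [genericPerturbation, t, ρR] using this

/-- For a general choice of the coefficients, every prime `q` of `V(I)` at which `c` does not vanish
is isolated in its fibre in the common zero locus of the functions `φ + c ∑ tₚ fⱼ ^ (e + 2)`. -/
theorem exists_generic_isolated {k R S : Type u} [Field k] [CommRing R] [CommRing S]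
    [Algebra k R] [Algebra R S] [Algebra k S] [IsScalarTower k R S] [Algebra.FiniteType R S]
    {n r : ℕ} {ι : Type} [Fintype ι] {G : Finset R} (hG : Algebra.adjoin k (G : Set R) = ⊤)
    (hr : G.card < r) {χ : MvPolynomial (Fin n) R →+* S} (hχ : χ.QuasiFinite)
    (hχC : χ.comp MvPolynomial.C = algebraMap R S) {φ : Fin n → S} {f : ι → S} {c : S}
    (I : Ideal S) [Algebra.QuasiFinite R (S ⧸ I)]
    (hIf : ∀ q : Ideal S, q.IsPrime → (I ≤ q ↔ ∀ j, f j ∈ q))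
    (hIφ : ∀ q : Ideal S, q.IsPrime → I ≤ q → ∀ i, φ i ∈ q) :
    ∃ g : MvPolynomial (Fin n × ι × Fin r) k, g ≠ 0 ∧ ∀ a : Fin n × ι × Fin r → k,
      MvPolynomial.eval a g ≠ 0 → ∀ q : Ideal S, q.IsPrime → I ≤ q → c ∉ q →
        ∃ s ∉ q, ∀ q' : Ideal S, q'.IsPrime → s ∉ q' →
          (∀ i, φ i + c * ∑ p : ι × Fin r, algebraMap k S (a (i, p)) * f p.1 ^ ((p.2 : ℕ) + 2) ∈ q')
          → q'.under R = q.under R → q' = q := by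
  classical
  let σ := Fin n × ι × Fin r
  let RT := MvPolynomial σ R
  let ST := MvPolynomial σ S
  let Ψ : Ideal ST := Ideal.span (Set.range (genericPerturbation φ f c))
  -- Avoiding `M` means that `c` does not vanish and that the coefficients are generic over `k`.
  let M : Submonoid (ST ⧸ Ψ) := (Submonoid.map (Ideal.Quotient.mk Ψ)
    (Submonoid.powers (MvPolynomial.C c) ⊔
      (nonZeroDivisors (MvPolynomial σ k)).map (MvPolynomial.map (algebraMap k S))))
  have : Algebra.FiniteType RT ST :=
    .equiv inferInstance (Algebra.IsPushout.equiv R RT S ST)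
  have : Algebra.QuasiFinite RT (MvPolynomial σ (S ⧸ I)) :=
    (Algebra.QuasiFinite.iff_of_algEquiv
      (Algebra.IsPushout.equiv R RT (S ⧸ I) (MvPolynomial σ (S ⧸ I)))).1 inferInstance
  let π : ST →ₐ[RT] MvPolynomial σ (S ⧸ I) :=
    { MvPolynomial.map (Ideal.Quotient.mk I) with
      commutes' := fun x => MvPolynomial.map_map _ _ x }
  have hπ : Function.Surjective π := MvPolynomial.map_surjective _ Ideal.Quotient.mk_surjective
  have hker : RingHom.ker π = I.map MvPolynomial.C := by
    have h := MvPolynomial.ker_map (σ := σ) (Ideal.Quotient.mk I)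
    rwa [Ideal.mk_ker] at h
  have hcomap : Function.Injective (Ideal.comap (Ideal.Quotient.mk Ψ)) :=
    Ideal.comap_injective_of_surjective _ Ideal.Quotient.mk_surjective
  have : Algebra.FiniteType RT (ST ⧸ Ψ) := inferInstance
  obtain ⟨g, hgM, hg⟩ := Algebra.QuasiFiniteAt.exists_mem_submonoid (R := RT)
    ((I.map MvPolynomial.C).map (Ideal.Quotient.mk Ψ)) M (by
      intro Q hQ hIQ hdisj
      refine .of_forall_eq Q fun Q' hQ' hunder hle => ?_
      set P := Q.comap (Ideal.Quotient.mk Ψ) with hP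
      set P' := Q'.comap (Ideal.Quotient.mk Ψ) with hP'
      have hIP : I.map MvPolynomial.C ≤ P := Ideal.map_le_iff_le_comap.1 hIQ
      have hPP' : P'.under RT = P.under RT := hunder
      refine hcomap ?_
      -- A specialization of `Q` stays in `V(I)`, which is quasi-finite over the base. A
      -- generalization may leave `V(I)`; then some `f j` lies in `P` but not in `P'`, and the
      -- dimension count contradicts `G.card < r`.
      rcases hle with hle | hle
      · by_cases hIP' : I.map MvPolynomial.C ≤ P'
        · exact Ideal.eq_of_le_of_quasiFinite_of_surjective π hπ (hker.trans_le hIP')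
            (Ideal.comap_mono hle) hPP'
        rw [Ideal.map_le_iff_le_comap] at hIP hIP'
        rw [hIf _ inferInstance] at hIP hIP'
        push Not at hIP'
        obtain ⟨j, hj⟩ := hIP'
        have hdisj' : ∀ x, x ∈ Submonoid.powers (MvPolynomial.C c) ⊔
            (nonZeroDivisors (MvPolynomial σ k)).map (MvPolynomial.map (algebraMap k S)) → x ∉ P' :=
          fun x hx hxP => Set.disjoint_left.1 hdisj (hle hxP) (Submonoid.mem_map_of_mem _ hx)
        refine absurd (le_card_of_genericPerturbation hG hχ hχC (P := P') (Q := P)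
          (Ideal.comap_mono hle) hPP' (φ := φ) (f := f) (c := c) (fun i => ?_) (hIP j) hj
          (hdisj' _ (Submonoid.mem_sup_left (Submonoid.mem_powers _))) (fun g hg => ?_)) hr.not_ge
        · have hi : genericPerturbation φ f c i ∈ Ψ := Ideal.subset_span ⟨i, rfl⟩
          rw [hP', Ideal.mem_comap, Ideal.Quotient.eq_zero_iff_mem.2 hi]
          exact Q'.zero_mem
        · by_contra hg₀
          exact hdisj' _ (Submonoid.mem_sup_right
            ⟨g, mem_nonZeroDivisors_of_ne_zero hg₀, rfl⟩) hg
      · exact (Ideal.eq_of_le_of_quasiFinite_of_surjective π hπ (hker.trans_le hIP)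
          (Ideal.comap_mono hle) hPP'.symm).symm)
  obtain ⟨_, hM, rfl⟩ := hgM
  -- The spreading-out element has the form `c ^ m * g`; its factor `g` is the required condition on
  -- the coefficients.
  obtain ⟨_, ⟨m, rfl⟩, _, ⟨g, hg₀, rfl⟩, rfl⟩ := Submonoid.mem_sup.1 hM
  refine ⟨g, nonZeroDivisors.ne_zero hg₀, fun a ha q hq hIq hcq => ?_⟩
  let ev : ST →+* S := MvPolynomial.eval fun p => algebraMap k S (a p)
  have hev : Function.Surjective ev := fun x => ⟨MvPolynomial.C x, MvPolynomial.eval_C x⟩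
  have hevC : ∀ x, ev (MvPolynomial.C x) = x := fun x => MvPolynomial.eval_C x
  have hevX : ∀ p, ev (MvPolynomial.X p) = algebraMap k S (a p) := fun p => MvPolynomial.eval_X p
  have hevR : ∀ x : RT, ev (algebraMap RT ST x) =
      algebraMap R S (MvPolynomial.eval (fun p => algebraMap k R (a p)) x) := by
    intro x
    change MvPolynomial.eval _ (MvPolynomial.map (algebraMap R S) x) = _
    rw [MvPolynomial.eval_map, MvPolynomial.eval₂_comp]
    simp only [IsScalarTower.algebraMap_apply k R S]
    rfl
  have hevψ : ∀ i, ev (genericPerturbation φ f c i) =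
      φ i + c * ∑ p : ι × Fin r, algebraMap k S (a (i, p)) * f p.1 ^ ((p.2 : ℕ) + 2) := by
    intro i
    simp only [genericPerturbation, map_add, map_mul, map_sum, map_pow, hevC, hevX]
  have hlift : ∀ q' : Ideal S, q'.IsPrime →
      (∀ i, φ i + c * ∑ p : ι × Fin r, algebraMap k S (a (i, p)) * f p.1 ^ ((p.2 : ℕ) + 2) ∈ q') →
      ((q'.comap ev).map (Ideal.Quotient.mk Ψ)).IsPrime ∧
        ((q'.comap ev).map (Ideal.Quotient.mk Ψ)).comap (Ideal.Quotient.mk Ψ) = q'.comap ev := by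
    intro q' hq' h
    have hle : RingHom.ker (Ideal.Quotient.mk Ψ) ≤ q'.comap ev := by
      rw [Ideal.mk_ker, Ideal.span_le]
      rintro _ ⟨i, rfl⟩
      rw [SetLike.mem_coe, Ideal.mem_comap, hevψ]
      exact h i
    refine ⟨Ideal.map_isPrime_of_surjective Ideal.Quotient.mk_surjective hle, ?_⟩
    rw [Ideal.comap_map_of_surjective _ Ideal.Quotient.mk_surjective, ← RingHom.ker_eq_comap_bot,
      sup_eq_left.2 hle]
  -- Every perturbation still vanishes on `V(I)`, whatever the coefficients.
  have hψq : ∀ i, φ i + c * ∑ p : ι × Fin r,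
      algebraMap k S (a (i, p)) * f p.1 ^ ((p.2 : ℕ) + 2) ∈ q := fun i =>
    q.add_mem (hIφ q hq hIq i) (q.mul_mem_left _ (q.sum_mem fun p _ => q.mul_mem_left _
      (q.pow_mem_of_mem ((hIf q hq).1 hIq p.1) _ (Nat.succ_pos _))))
  obtain ⟨hQ, hQq⟩ := hlift q hq hψq
  set Q := (q.comap ev).map (Ideal.Quotient.mk Ψ) with hQ_def
  have : Algebra.QuasiFiniteAt RT Q := by
    refine hg Q ?_ ?_
    · refine Ideal.map_mono (Ideal.map_le_iff_le_comap.2 fun x hx => ?_)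
      rw [Ideal.mem_comap, Ideal.mem_comap, MvPolynomial.eval_C]
      exact hIq hx
    · rw [← Ideal.mem_comap, hQq, Ideal.mem_comap, map_mul, MvPolynomial.eval_map]
      have h₁ : ev (MvPolynomial.C c ^ m) = c ^ m := by rw [map_pow, hevC]
      have h₂ : MvPolynomial.eval₂ (algebraMap k S) (fun p => algebraMap k S (a p)) g =
          algebraMap k S (MvPolynomial.eval a g) :=
        (MvPolynomial.eval₂_comp _ _ _).symm
      intro h
      rcases hq.mem_or_mem h with h | h
      · exact hcq (hq.mem_of_pow_mem m (h₁ ▸ h))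
      · exact hq.ne_top (Ideal.eq_top_of_isUnit_mem _ (h₂ ▸ h) ((isUnit_iff_ne_zero.2 ha).map _))
  -- Quasi-finiteness at `Q` isolates it in its fibre over `R[t]`; evaluating the isolating element
  -- at `a` isolates `q` in its fibre over `R`.
  obtain ⟨s, hs, hs'⟩ := Ideal.exists_not_mem_forall_mem_of_ne_of_liesOver (Q.under RT) Q
  obtain ⟨s, rfl⟩ := Ideal.Quotient.mk_surjective s
  rw [← Ideal.mem_comap, hQq] at hs
  refine ⟨ev s, hs, fun q' hq' hsq' hψ hunder => ?_⟩
  obtain ⟨hQ', hQq'⟩ := hlift q' hq' hψ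
  by_contra hne
  refine hsq' ?_
  rw [← Ideal.mem_comap, ← hQq', Ideal.mem_comap]
  refine hs' _ hQ' (fun h => hne ?_) ⟨?_⟩
  · refine Ideal.comap_injective_of_surjective ev hev ?_
    rw [← hQq', ← hQq, h]
  · change (Q.comap (Ideal.Quotient.mk Ψ)).under RT =
      (((q'.comap ev).map (Ideal.Quotient.mk Ψ)).comap (Ideal.Quotient.mk Ψ)).under RT
    rw [hQq, hQq']
    ext x
    rw [Ideal.mem_under, Ideal.mem_under, Ideal.mem_comap, Ideal.mem_comap, hevR,
      ← Ideal.mem_under, ← hunder, Ideal.mem_under]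

end GenericPerturbation

/-! ### Isolated points and translation to affine charts. -/

namespace FramedCorrespondence

/-- The point `v` of the common zero locus of the functions `φ` on `V` is isolated in its fibre
over `S`. -/
def IsolatedAt {S V : Scheme.{u}} {n : ℕ} (π : V ⟶ S) (φ : Fin n → Γ(V, ⊤)) (v : V) : Prop :=
  ∃ O : V.Opens, v ∈ O ∧ ∀ v' ∈ O, (∀ i, VanishesAt (φ i) v') → π v' = π v → v' = v

theorem exists_affine_chart {S V : Scheme.{u}} (π : V ⟶ S) (v : V) :
    ∃ (R T : CommRingCat.{u}) (γ : R ⟶ T) (i : Spec R ⟶ S) (j : Spec T ⟶ V),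
      IsOpenImmersion i ∧ IsOpenImmersion j ∧ j ≫ π = Spec.map γ ≫ i ∧ v ∈ Set.range j := by
  obtain ⟨R, i, _, hi, -⟩ := Scheme.exists_affine_mem_range_and_range_subset
    (U := (⊤ : S.Opens)) (x := π v) trivial
  obtain ⟨T, j, _, hj, hjr⟩ := Scheme.exists_affine_mem_range_and_range_subset
    (U := π ⁻¹ᵁ i.opensRange) (x := v) hi
  have hr : Set.range (j ≫ π) ⊆ Set.range i := by
    rintro _ ⟨q, rfl⟩
    exact hjr ⟨q, rfl⟩
  refine ⟨R, T, Spec.preimage (IsOpenImmersion.lift i (j ≫ π) hr), i, j, ‹_›, ‹_›, ?_, hj⟩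
  rw [Spec.map_preimage, IsOpenImmersion.lift_fac]

/-- The restriction of a global function along `j : Spec T ⟶ V`. -/
noncomputable def specRes {V : Scheme.{u}} {T : CommRingCat.{u}} (j : Spec T ⟶ V) : Γ(V, ⊤) →+* T :=
  (j.appTop ≫ (Scheme.ΓSpecIso T).hom).hom

theorem vanishesAt_spec_iff {V : Scheme.{u}} {T : CommRingCat.{u}} (j : Spec T ⟶ V) (f : Γ(V, ⊤))
    (q : Spec T) : VanishesAt f (j q) ↔ specRes j f ∈ q.asIdeal := by
  rw [← vanishesAt_appTop, vanishesAt_iff, basicOpen_eq_of_affine']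
  exact not_not

theorem specRes_comp {V W : Scheme.{u}} {R T : CommRingCat.{u}} {γ : R ⟶ T} {i : Spec R ⟶ W}
    {j : Spec T ⟶ V} {π : V ⟶ W} (h : j ≫ π = Spec.map γ ≫ i) (x : Γ(W, ⊤)) :
    specRes j (π.appTop x) = γ (specRes i x) := by
  have h₁ := appTop_congr h x
  change (Scheme.ΓSpecIso T).hom (j.appTop (π.appTop x)) = γ ((Scheme.ΓSpecIso R).hom (i.appTop x))
  rw [h₁, ← CommRingCat.comp_apply, ← CommRingCat.comp_apply, ← CommRingCat.comp_apply,
    ← Scheme.ΓSpecIso_naturality]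
  rfl

theorem locallyQuasiFinite_of_etale {V T : Scheme.{u}} (e : V ⟶ T) [Etale e] :
    LocallyQuasiFinite e where
  quasiFinite_appLE {U} hU {W} hW h := by
    have h₁ : (e.appLE U W h).hom.Etale := e.etale_appLE hU hW h
    algebraize [(e.appLE U W h).hom]
    exact inferInstanceAs (Algebra.QuasiFinite Γ(T, U) Γ(V, W))

theorem mem_range_redι {T : Scheme.{u}} (Z : Closeds T) (x : T) : x ∈ Set.range (redι Z) ↔ x ∈ Z := by
  rw [Scheme.IdealSheafData.range_subschemeι, Scheme.IdealSheafData.coe_support_vanishingIdeal]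
  rfl

theorem mem_range_lift {V T : Scheme.{u}} {e : V ⟶ T} {Z : Closeds T}
    {c : (Scheme.IdealSheafData.vanishingIdeal Z).subscheme ⟶ V}
    (hc : IsPullback c (𝟙 _) e (redι Z)) (v : V) : v ∈ Set.range c ↔ e v ∈ Z := by
  constructor
  · rintro ⟨z, rfl⟩
    rw [← mem_range_redι, ← Scheme.Hom.comp_apply, hc.w, Category.id_comp]
    exact ⟨z, rfl⟩
  · intro hv
    rw [← mem_range_redι] at hv
    rw [← hc.isoPullback_hom_fst, Scheme.Hom.comp_base, TopCat.coe_comp,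
      Set.range_comp, (hc.isoPullback.hom.surjective).range_eq, Set.image_univ,
      Scheme.Pullback.range_fst]
    exact hv

end FramedCorrespondence

namespace FramedCorrespondence

/-- The constant functions on a scheme over a field. -/
noncomputable def constFun {k : Type u} [CommRing k] {V : Scheme.{u}}
    (p : V ⟶ Spec (CommRingCat.of k)) : k →+* Γ(V, ⊤) :=
  ((Scheme.ΓSpecIso (.of k)).inv ≫ p.appTop).hom

theorem specRes_constFun {k : Type u} [CommRing k] {V : Scheme.{u}}
    (p : V ⟶ Spec (CommRingCat.of k)) {T : CommRingCat.{u}} {j : Spec T ⟶ V}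
    {κ : CommRingCat.of k ⟶ T} (h : j ≫ p = Spec.map κ) (x : k) :
    specRes j (constFun p x) = κ x := by
  have h₁ : j ≫ p = Spec.map κ ≫ 𝟙 _ := by rw [h, Category.comp_id]
  refine (specRes_comp h₁ ((Scheme.ΓSpecIso (.of k)).inv x)).trans ?_
  congr 1
  change ((Scheme.ΓSpecIso (.of k)).inv ≫ Scheme.Hom.appTop (𝟙 _) ≫
    (Scheme.ΓSpecIso (.of k)).hom).hom x = x
  simp

/-- An étale morphism is locally quasi-finite, so the `n` affine coordinates control all functions
on the chart up to algebraic dependence. -/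
theorem exists_quasiFinite_coordinates {S V : Scheme.{u}} {n : ℕ} (e : V ⟶ Aff n S) [Etale e]
    {R T : CommRingCat.{u}} {γ : R ⟶ T} {i : Spec R ⟶ S} {j : Spec T ⟶ V} [IsOpenImmersion i]
    [IsOpenImmersion j] (h : j ≫ e ≫ Aff.pr n S = Spec.map γ ≫ i) :
    ∃ χ : MvPolynomial (Fin n) R →+* T, χ.QuasiFinite ∧ χ.comp MvPolynomial.C = γ.hom := by
  let N := ULift.{u} (Fin n)
  let m : Spec T ⟶ Aff n (Spec R) := AffineSpace.homOfVector (Spec.map γ)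
    fun l => j.appTop (e.appTop (AffineSpace.coord S l))
  have hm : m ≫ AffineSpace.map N i = j ≫ e := by
    refine AffineSpace.hom_ext ?_ fun l => ?_
    · rw [Category.assoc, AffineSpace.map_over, AffineSpace.homOfVector_over_assoc, ← h,
        Category.assoc]
    · rw [Scheme.Hom.comp_appTop, CommRingCat.comp_apply, AffineSpace.map_appTop_coord,
        AffineSpace.homOfVector_appTop_coord, Scheme.Hom.comp_appTop, CommRingCat.comp_apply]
  have : LocallyQuasiFinite e := locallyQuasiFinite_of_etale e
  have : LocallyQuasiFinite (m ≫ AffineSpace.map N i) := by rw [hm]; infer_instance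
  have : LocallyQuasiFinite m := .of_comp m (AffineSpace.map N i)
  let χ := Spec.preimage (m ≫ (AffineSpace.SpecIso N R).hom)
  have hχ : Spec.map χ = m ≫ (AffineSpace.SpecIso N R).hom := Spec.map_preimage _
  have hqf : LocallyQuasiFinite (Spec.map χ) := by rw [hχ]; infer_instance
  rw [HasRingHomProperty.Spec_iff (P := @LocallyQuasiFinite)] at hqf
  have hC : CommRingCat.ofHom MvPolynomial.C ≫ χ = γ := by
    apply Spec.map_injective
    rw [Spec.map_comp, hχ, ← AffineSpace.SpecIso_inv_over, Category.assoc, Iso.hom_inv_id_assoc]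
    exact AffineSpace.homOfVector_over _ _
  let ρ := MvPolynomial.rename (R := R) (ULift.up : Fin n → N)
  have hρ : ρ.toRingHom.QuasiFinite := by
    refine .of_finite (RingHom.Finite.of_surjective _ ?_)
    exact MvPolynomial.rename_surjective _ ULift.up_surjective
  refine ⟨χ.hom.comp ρ.toRingHom, hqf.comp hρ, ?_⟩
  rw [← hC]
  ext x
  simp [ρ]

/-- The lift of `Z` to `V` is closed, being a base change of the inclusion of `Z`; its trace on the
chart inherits quasi-finiteness from the finiteness of `Z` over `S`. -/
theorem exists_ideal_quasiFinite {S V : Scheme.{u}} {n : ℕ} (e : V ⟶ Aff n S)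
    {Z : Closeds (Aff n S)} (hZ : IsFinite (redι Z ≫ Aff.pr n S)) (hnhd : IsNisnevichNhd e Z)
    {R T : CommRingCat.{u}} {γ : R ⟶ T} {i : Spec R ⟶ S} {j : Spec T ⟶ V} [IsOpenImmersion i]
    [IsOpenImmersion j] (h : j ≫ e ≫ Aff.pr n S = Spec.map γ ≫ i) :
    ∃ I : Ideal T, ((Ideal.Quotient.mk I).comp γ.hom).QuasiFinite ∧
      ∀ q : Spec T, I ≤ q.asIdeal ↔ e (j q) ∈ Z := by
  obtain ⟨c, hc⟩ := hnhd.isPullback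
  have : IsClosedImmersion c := MorphismProperty.of_isPullback (P := @IsClosedImmersion) hc.flip
    inferInstance
  obtain ⟨I, ε, hε⟩ := IsClosedImmersion.Spec_iff.1
    (inferInstance : IsClosedImmersion (pullback.snd c j))
  refine ⟨I, ?_, fun q => ?_⟩
  · have h₁ : Spec.map (γ ≫ CommRingCat.ofHom (Ideal.Quotient.mk I)) ≫ i =
        ε.inv ≫ pullback.fst c j ≫ redι Z ≫ Aff.pr n S := by
      have hw : c ≫ e = redι Z := by rw [hc.w, Category.id_comp]
      rw [Spec.map_comp, Category.assoc, ← h, ← hw, Category.assoc, pullback.condition_assoc, hε,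
        Category.assoc, Iso.inv_hom_id_assoc]
    have : LocallyQuasiFinite (Spec.map (γ ≫ CommRingCat.ofHom (Ideal.Quotient.mk I)) ≫ i) := by
      rw [h₁]
      infer_instance
    have h₂ : LocallyQuasiFinite (Spec.map (γ ≫ CommRingCat.ofHom (Ideal.Quotient.mk I))) :=
      .of_comp _ i
    rwa [HasRingHomProperty.Spec_iff (P := @LocallyQuasiFinite)] at h₂
  · have h₁ : q ∈ Set.range (Spec.map (CommRingCat.ofHom (Ideal.Quotient.mk I))) ↔
        I ≤ q.asIdeal := by
      change q ∈ Set.range (PrimeSpectrum.comap (Ideal.Quotient.mk I)) ↔ _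
      rw [range_comap_of_surjective _ _ Ideal.Quotient.mk_surjective, Ideal.mk_ker]
      rfl
    have h₂ : Set.range (pullback.snd c j) =
        Set.range (Spec.map (CommRingCat.ofHom (Ideal.Quotient.mk I))) := by
      rw [hε, Scheme.Hom.comp_base, TopCat.coe_comp, Set.range_comp,
        ε.hom.surjective.range_eq, Set.image_univ]
    rw [← h₁, ← h₂, Scheme.Pullback.range_snd, Set.mem_preimage, mem_range_lift hc]

end FramedCorrespondence

/-! ### Choice of coefficients in `k` valid along all of `Z`. -/

namespace FramedCorrespondence

/-- The functions `φᵢ + c ∑ tᵢⱼₘ fⱼ ^ (m + 2)`. -/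
noncomputable def perturb {k : Type u} [CommRing k] {V : Scheme.{u}}
    (p : V ⟶ Spec (CommRingCat.of k)) {n r : ℕ} {ι : Type} [Fintype ι] (φ : Fin n → Γ(V, ⊤))
    (c : Γ(V, ⊤)) (f : ι → Γ(V, ⊤)) (t : Fin n × ι × Fin r → k) (i : Fin n) : Γ(V, ⊤) :=
  φ i + c * ∑ l : ι × Fin r, constFun p (t (i, l)) * f l.1 ^ ((l.2 : ℕ) + 2)

theorem finiteType_of_chart {k : Type u} [Field k] {S : Scheme.{u}} (s : S ⟶ Spec (CommRingCat.of k))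
    [LocallyOfFiniteType s] {R : CommRingCat.{u}} (i : Spec R ⟶ S) [IsOpenImmersion i] :
    (Spec.preimage (i ≫ s)).hom.FiniteType := by
  rw [← HasRingHomProperty.Spec_iff (P := @LocallyOfFiniteType), Spec.map_preimage]
  infer_instance

theorem exists_opens_generic_isolatedAt {k : Type u} [Field k] {S V : Scheme.{u}}
    (s : S ⟶ Spec (CommRingCat.of k)) [LocallyOfFiniteType s] {n : ℕ} (e : V ⟶ Aff n S) [Etale e]
    {Z : Closeds (Aff n S)} (hZ : IsFinite (redι Z ≫ Aff.pr n S)) (hnhd : IsNisnevichNhd e Z)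
    {ι : Type} [Fintype ι] (φ : Fin n → Γ(V, ⊤)) (c : Γ(V, ⊤)) (f : ι → Γ(V, ⊤))
    (hφ : ∀ v, e v ∈ Z → ∀ i, VanishesAt (φ i) v)
    (hf : ∀ v, e v ∈ Z ↔ ∀ j, VanishesAt (f j) v) (v : V) :
    ∃ O : V.Opens, v ∈ O ∧ ∃ D : ℕ, ∀ r > D, ∃ g : MvPolynomial (Fin n × ι × Fin r) k, g ≠ 0 ∧
      ∀ t, MvPolynomial.eval t g ≠ 0 → ∀ v' ∈ O, e v' ∈ Z → ¬ VanishesAt c v' →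
        IsolatedAt (e ≫ Aff.pr n S) (perturb ((e ≫ Aff.pr n S) ≫ s) φ c f t) v' := by
  obtain ⟨R, T, γ, i, j, _, _, h, hv⟩ := exists_affine_chart (e ≫ Aff.pr n S) v
  obtain ⟨χ, hχ, hχC⟩ := exists_quasiFinite_coordinates e h
  obtain ⟨I, hI, hIZ⟩ := exists_ideal_quasiFinite e hZ hnhd h
  have hκ := finiteType_of_chart s i
  set κ := Spec.preimage (i ≫ s)
  have hκs : Spec.map κ = i ≫ s := Spec.map_preimage _
  have hγ : γ.hom.FiniteType := by
    have : LocallyOfFiniteType ((e ≫ Aff.pr n S)) := inferInstance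
    have : LocallyOfFiniteType (Spec.map γ ≫ i) := by rw [← h]; infer_instance
    have : LocallyOfFiniteType (Spec.map γ) := locallyOfFiniteType_of_comp _ i
    rwa [HasRingHomProperty.Spec_iff (P := @LocallyOfFiniteType)] at this
  refine ⟨j.opensRange, hv, ?_⟩
  let _ : Algebra k R := κ.hom.toAlgebra
  let _ : Algebra R T := γ.hom.toAlgebra
  let _ : Algebra k T := (γ.hom.comp κ.hom).toAlgebra
  have : IsScalarTower k R T := .of_algebraMap_eq' rfl
  have : Algebra.FiniteType R T := hγ
  have : Algebra.FiniteType k R := hκ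
  have : Algebra.QuasiFinite R (T ⧸ I) := hI
  obtain ⟨G, hG⟩ := ‹Algebra.FiniteType k R›.out
  have hp : j ≫ (e ≫ Aff.pr n S) ≫ s = Spec.map (κ ≫ γ) := by
    rw [← Category.assoc, h, Category.assoc, Spec.map_comp, hκs]
  -- The threshold depends only on the chart of the base, so one `r` can later serve finitely many
  -- charts.
  refine ⟨G.card, fun r hr => ?_⟩
  obtain ⟨g, hg, H⟩ := exists_generic_isolated (φ := fun l => specRes j (φ l))
    (f := fun l => specRes j (f l)) (c := specRes j c) hG hr hχ hχC I
    (fun q hq => by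
      simp only [← vanishesAt_spec_iff j _ ⟨q, hq⟩]
      rw [← hf]
      exact hIZ ⟨q, hq⟩)
    (fun q hq hIq l => (vanishesAt_spec_iff j _ ⟨q, hq⟩).1 (hφ _ ((hIZ ⟨q, hq⟩).1 hIq) l))
  refine ⟨g, hg, fun t ht => ?_⟩
  rintro _ ⟨q, rfl⟩ hqZ hqc
  rw [vanishesAt_spec_iff] at hqc
  obtain ⟨a, haq, ha⟩ := H t ht q.asIdeal q.isPrime ((hIZ q).2 hqZ) hqc
  refine ⟨j ''ᵁ PrimeSpectrum.basicOpen a, ⟨q, haq, rfl⟩, ?_⟩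
  rintro _ ⟨q', hq', rfl⟩ hvan hπ
  congr 1
  refine PrimeSpectrum.ext (ha q'.asIdeal q'.isPrime hq' (fun l => ?_) ?_)
  · have := (vanishesAt_spec_iff j _ _).1 (hvan l)
    simp only [perturb, map_add, map_mul, map_sum, map_pow, specRes_constFun _ hp] at this
    exact this
  · have h₁ : i (Spec.map γ q') = i (Spec.map γ q) := by
      rw [← Scheme.Hom.comp_apply, ← Scheme.Hom.comp_apply, ← h, Scheme.Hom.comp_apply,
        Scheme.Hom.comp_apply]
      exact hπ
    exact congrArg PrimeSpectrum.asIdeal (i.isOpenEmbedding.injective h₁)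

theorem isCompact_preimage_support {S V : Scheme.{u}} [CompactSpace S] {n : ℕ} {e : V ⟶ Aff n S}
    {Z : Closeds (Aff n S)} [IsFinite (redι Z ≫ Aff.pr n S)] (hnhd : IsNisnevichNhd e Z) :
    IsCompact {v | e v ∈ Z} := by
  obtain ⟨c, hc⟩ := hnhd.isPullback
  have : {v | e v ∈ Z} = Set.range c := Set.ext fun v => (mem_range_lift hc v).symm
  rw [this]
  have : CompactSpace (Scheme.IdealSheafData.vanishingIdeal Z).subscheme :=
    QuasiCompact.compactSpace_of_compactSpace (redι Z ≫ Aff.pr n S)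
  exact isCompact_range c.continuous

/-- The lift of `Z` is compact, so finitely many charts cover it. A common `r` exceeds all
thresholds, and over an infinite field the product of the resulting nonzero polynomials has a point
of nonvanishing. -/
theorem exists_isolatedAt_perturb {k : Type u} [Field k] [Infinite k] {S V : Scheme.{u}}
    [CompactSpace S]
    (s : S ⟶ Spec (CommRingCat.of k)) [LocallyOfFiniteType s] {n : ℕ} (e : V ⟶ Aff n S) [Etale e]
    {Z : Closeds (Aff n S)} (hZ : IsFinite (redι Z ≫ Aff.pr n S)) (hnhd : IsNisnevichNhd e Z)
    {ι : Type} [Fintype ι] (φ : Fin n → Γ(V, ⊤)) (c : Γ(V, ⊤)) (f : ι → Γ(V, ⊤))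
    (hφ : ∀ v, e v ∈ Z → ∀ i, VanishesAt (φ i) v)
    (hf : ∀ v, e v ∈ Z ↔ ∀ j, VanishesAt (f j) v) :
    ∃ (r : ℕ) (t : Fin n × ι × Fin r → k), ∀ v, e v ∈ Z → ¬ VanishesAt c v →
      IsolatedAt (e ≫ Aff.pr n S) (perturb ((e ≫ Aff.pr n S) ≫ s) φ c f t) v := by
  choose O hvO D hD using exists_opens_generic_isolatedAt s e hZ hnhd φ c f hφ hf
  obtain ⟨F, hF⟩ := (isCompact_preimage_support hnhd).elim_finite_subcover
    (fun v => (O v : Set V)) (fun v => (O v).isOpen)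
    (fun v _ => Set.mem_iUnion.2 ⟨v, hvO v⟩)
  have hr : ∀ v : F, D v < F.sup D + 1 := fun v => Nat.lt_succ_of_le (Finset.le_sup v.2)
  choose g hg H using fun v : F => hD v _ (hr v)
  have hprod : ∏ v, g v ≠ 0 := Finset.prod_ne_zero_iff.2 fun v _ => hg v
  obtain ⟨t, ht⟩ : ∃ t, MvPolynomial.eval t (∏ v, g v) ≠ 0 := by
    by_contra! h
    exact hprod (MvPolynomial.funext fun t => by rw [h t, map_zero])
  rw [map_prod, Finset.prod_ne_zero_iff] at ht
  refine ⟨_, t, fun v hv hc => ?_⟩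
  obtain ⟨w, hw, hvw⟩ := Set.mem_iUnion₂.1 (hF hv)
  exact H ⟨w, hw⟩ t (ht _ (Finset.mem_univ _)) v hvw hv hc

end FramedCorrespondence

/-! ### The zero scheme of a framing and shrinking to quasi-finiteness. -/

namespace FramedCorrespondence

theorem zeroSection_pr (n : ℕ) (S : Scheme.{u}) :
    ExplicitCorr.zeroSection n S ≫ Aff.pr n S = 𝟙 S :=
  AffineSpace.homOfVector_over _ _

instance isClosedImmersion_zeroSection (n : ℕ) (S : Scheme.{u}) :
    IsClosedImmersion (ExplicitCorr.zeroSection n S) := by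
  have : IsClosedImmersion (ExplicitCorr.zeroSection n S ≫ Aff.pr n S) := by
    rw [zeroSection_pr]
    infer_instance
  exact .of_comp _ (Aff.pr n S)

theorem isOpen_singleton_asFiber_of_isolated {P S : Scheme.{u}} (p : P ⟶ S) (x : P) (O : P.Opens)
    (hx : x ∈ O) (h : ∀ y ∈ O, p y = p x → y = x) : IsOpen {p.asFiber x} := by
  have : {p.asFiber x} = (p.fiberι (p x)) ⁻¹' (O : Set P) := by
    ext y
    constructor
    · rintro rfl
      rw [Set.mem_preimage, Scheme.Hom.fiberι_asFiber]
      exact hx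
    · intro hy
      have hy' : p (p.fiberι (p x) y) = p x := by
        have : p.fiberι (p x) y ∈ Set.range (p.fiberι (p x)) := ⟨y, rfl⟩
        rwa [Scheme.Hom.range_fiberι] at this
      refine (p.fiberι (p x)).isEmbedding.injective ?_
      rw [Scheme.Hom.fiberι_asFiber]
      exact h _ hy hy'
  rw [this]
  exact O.isOpen.preimage (p.fiberι (p x)).continuous

namespace ExplicitCorr

section

variable {B : Scheme.{u}} {n : ℕ} {S X : Over B} {Y : Closeds X.left}

/-- The inclusion `φ⁻¹(0) ⟶ V`. -/
noncomputable def zeroIncl (a : ExplicitCorr n S X Y) :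
    pullback a.framing (zeroSection n S.left) ⟶ a.V :=
  pullback.fst _ _

instance (a : ExplicitCorr n S X Y) : IsClosedImmersion a.zeroIncl := by
  unfold zeroIncl
  infer_instance

theorem framing_pr (a : ExplicitCorr n S X Y) :
    a.framing ≫ Aff.pr n S.left = a.e ≫ Aff.pr n S.left :=
  AffineSpace.homOfVector_over _ _

theorem zeroIncl_comp (a : ExplicitCorr n S X Y) :
    a.zeroIncl ≫ a.e ≫ Aff.pr n S.left = a.zeroFibre := by
  rw [← framing_pr]
  unfold zeroIncl zeroFibre
  rw [pullback.condition_assoc, zeroSection_pr, Category.comp_id]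

theorem vanishesAt_zeroIncl (a : ExplicitCorr n S X Y)
    (x : (pullback a.framing (zeroSection n S.left) : Scheme.{u})) (i : Fin n) :
    VanishesAt (a.φ i) (a.zeroIncl x) := by
  have h₁ : a.framing.appTop (AffineSpace.coord S.left ⟨i⟩) = a.φ i :=
    AffineSpace.homOfVector_appTop_coord _ _ _
  have h₂ : (zeroSection n S.left).appTop (AffineSpace.coord S.left ⟨i⟩) = 0 :=
    AffineSpace.homOfVector_appTop_coord _ _ _
  rw [← vanishesAt_appTop, ← h₁]
  unfold zeroIncl
  rw [appTop_congr pullback.condition, h₂, map_zero]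
  exact map_zero _

/-- The residue field point of `v` is sent by the framing into the zero section, hence factors
through the fibre product. -/
theorem mem_range_zeroIncl (a : ExplicitCorr n S X Y) (v : a.V) (h : ∀ i, VanishesAt (a.φ i) v) :
    v ∈ Set.range a.zeroIncl := by
  obtain ⟨q⟩ : Nonempty (Spec (a.V.residueField v)) := inferInstance
  have h₁ : a.V.fromSpecResidueField v ≫ a.framing =
      (a.V.fromSpecResidueField v ≫ a.e ≫ Aff.pr n S.left) ≫ zeroSection n S.left := by
    refine AffineSpace.hom_ext ?_ fun l => ?_
    · rw [Category.assoc, Category.assoc, framing_pr, zeroSection_pr, Category.comp_id]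
    · have h₁ : a.framing.appTop (AffineSpace.coord S.left l) = a.φ l.down :=
        AffineSpace.homOfVector_appTop_coord _ _ _
      have h₂ : (zeroSection n S.left).appTop (AffineSpace.coord S.left l) = 0 :=
        AffineSpace.homOfVector_appTop_coord _ _ _
      rw [Scheme.Hom.comp_appTop, Scheme.Hom.comp_appTop, CommRingCat.comp_apply,
        CommRingCat.comp_apply, h₁, h₂, map_zero]
      have hv : VanishesAt (a.φ l.down) (a.V.fromSpecResidueField v q) := by
        rw [Scheme.fromSpecResidueField_apply]
        exact h _
      rw [vanishesAt_spec_iff] at hv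
      have h0 : specRes (a.V.fromSpecResidueField v) (a.φ l.down) = 0 := by
        by_contra hne
        exact q.isPrime.ne_top (Ideal.eq_top_of_isUnit_mem _ hv (isUnit_iff_ne_zero.2 hne))
      refine (ConcreteCategory.bijective_of_isIso
        (Scheme.ΓSpecIso (a.V.residueField v)).hom).1 ?_
      rw [map_zero]
      exact h0
  refine ⟨pullback.lift _ _ h₁ q, ?_⟩
  unfold zeroIncl
  rw [← Scheme.Hom.comp_apply, pullback.lift_fst, Scheme.fromSpecResidueField_apply]

theorem isolatedAt_of_isQuasiFinite {a : ExplicitCorr n S X Y}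
    (ha : LocallyQuasiFinite a.zeroFibre) (v : a.V) (hv : ∀ i, VanishesAt (a.φ i) v) :
    IsolatedAt (a.e ≫ Aff.pr n S.left) a.φ v := by
  obtain ⟨x, rfl⟩ := a.mem_range_zeroIncl v hv
  have hπ : ∀ y, (a.e ≫ Aff.pr n S.left) (a.zeroIncl y) = a.zeroFibre y := fun y => by
    rw [← Scheme.Hom.comp_apply, zeroIncl_comp]
  have hd := (a.zeroFibre.isDiscrete_preimage_singleton (a.zeroFibre x)).1
  obtain ⟨U, hU, hUx⟩ := isOpen_induced_iff.1 (isOpen_discrete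
    ({⟨x, rfl⟩} : Set (a.zeroFibre ⁻¹' {a.zeroFibre x})))
  obtain ⟨O, hO, rfl⟩ := a.zeroIncl.isClosedEmbedding.isInducing.isOpen_iff.1 hU
  refine ⟨⟨O, hO⟩, ?_, fun v' hv' h₁ h₂ => ?_⟩
  · exact hUx.ge rfl
  · obtain ⟨y, rfl⟩ := a.mem_range_zeroIncl v' h₁
    rw [hπ, hπ] at h₂
    have : (⟨y, h₂⟩ : a.zeroFibre ⁻¹' {a.zeroFibre x}) ∈ ({⟨x, rfl⟩} : Set _) := hUx.le hv'
    exact congrArg a.zeroIncl (congrArg Subtype.val (Set.mem_singleton_iff.1 this))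

theorem quasiFiniteAt_of_isolatedAt (a : ExplicitCorr n S X Y) [LocallyOfFiniteType a.zeroFibre]
    (x : (pullback a.framing (zeroSection n S.left) : Scheme.{u}))
    (h : IsolatedAt (a.e ≫ Aff.pr n S.left) a.φ (a.zeroIncl x)) : a.zeroFibre.QuasiFiniteAt x := by
  have hπ : ∀ y, (a.e ≫ Aff.pr n S.left) (a.zeroIncl y) = a.zeroFibre y := fun y => by
    rw [← Scheme.Hom.comp_apply, zeroIncl_comp]
  obtain ⟨O, hO, H⟩ := h
  rw [Scheme.Hom.quasiFiniteAt_iff_isOpen_singleton_asFiber]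
  refine isOpen_singleton_asFiber_of_isolated _ x (a.zeroIncl ⁻¹ᵁ O) hO fun y hy hyx => ?_
  refine a.zeroIncl.isClosedEmbedding.injective (H _ hy (a.vanishesAt_zeroIncl y) ?_)
  rw [hπ, hπ, hyx]

theorem locallyOfFiniteType_zeroFibre (a : ExplicitCorr n S X Y) :
    LocallyOfFiniteType a.zeroFibre := by
  have := a.nhd.etale
  rw [← zeroIncl_comp]
  infer_instance

/-- The restriction of an explicit correspondence to an open neighbourhood of its support. -/
noncomputable def restrict (a : ExplicitCorr n S X Y) (W : a.V.Opens)
    (hW : ∀ v, a.e v ∈ a.Z → v ∈ W) : ExplicitCorr n S X Y where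
  Z := a.Z
  V := W
  e := W.ι ≫ a.e
  φ := fun i => W.ι.appTop (a.φ i)
  g := W.ι ≫ a.g
  g_over := by simp [a.g_over]
  finite := a.finite
  nhd := by
    have := a.nhd.etale
    refine ⟨inferInstance, ?_⟩
    obtain ⟨c, hc⟩ := a.nhd.isPullback
    have hr : Set.range c ⊆ Set.range W.ι := by
      rintro v hv
      rw [Scheme.Opens.range_ι]
      exact hW v ((mem_range_lift hc v).1 hv)
    have hl := IsOpenImmersion.lift_fac W.ι c hr
    have h := (IsPullback.of_vert_isIso_mono
      ⟨hl.trans (Category.id_comp c).symm⟩ : IsPullback _ (𝟙 _) W.ι c).paste_vert hc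
    rw [Category.comp_id] at h
    exact ⟨_, h⟩
  support := by
    intro v
    simp only [vanishesAt_appTop, Scheme.Hom.comp_apply]
    exact a.support _

/-- The inclusion of the neighbourhood of a restricted explicit correspondence. -/
noncomputable def restrictι (a : ExplicitCorr n S X Y) (W : a.V.Opens)
    (hW : ∀ v, a.e v ∈ a.Z → v ∈ W) : (a.restrict W hW).V ⟶ a.V := W.ι

instance (a : ExplicitCorr n S X Y) (W : a.V.Opens) (hW : ∀ v, a.e v ∈ a.Z → v ∈ W) :
    IsOpenImmersion (a.restrictι W hW) :=
  inferInstanceAs (IsOpenImmersion W.ι)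

theorem restrict_refines (a : ExplicitCorr n S X Y) (W : a.V.Opens)
    (hW : ∀ v, a.e v ∈ a.Z → v ∈ W) : (a.restrict W hW).Refines a :=
  ⟨rfl, W.ι, rfl, fun _ => rfl, rfl⟩

theorem Refines.refl (a : ExplicitCorr n S X Y) : a.Refines a :=
  ⟨rfl, 𝟙 _, Category.id_comp _, fun i => by simp, Category.id_comp _⟩

theorem framing_restrict (a : ExplicitCorr n S X Y) (W : a.V.Opens)
    (hW : ∀ v, a.e v ∈ a.Z → v ∈ W) :
    (a.restrict W hW).framing = a.restrictι W hW ≫ a.framing := by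
  unfold framing
  rw [AffineSpace.comp_homOfVector]
  simp only [restrict, Category.assoc]
  rfl

theorem locallyQuasiFinite_zeroFibre_restrict (a : ExplicitCorr n S X Y)
    [LocallyOfFiniteType a.zeroFibre] (W : a.V.Opens)
    (hW : ∀ v, a.e v ∈ a.Z → v ∈ W)
    (h : ∀ x, a.zeroIncl x ∈ W → a.zeroFibre.QuasiFiniteAt x) :
    LocallyQuasiFinite (a.restrict W hW).zeroFibre := by
  let m : pullback (a.restrict W hW).framing (zeroSection n S.left) ⟶
      pullback a.framing (zeroSection n S.left) :=
    pullback.map _ _ _ _ (a.restrictι W hW) (𝟙 _) (𝟙 _)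
      (by rw [framing_restrict, Category.comp_id]) (by simp)
  have hm : m ≫ a.zeroFibre = (a.restrict W hW).zeroFibre :=
    (pullback.lift_snd _ _ _).trans (Category.comp_id _)
  have hm' : m ≫ a.zeroIncl = (a.restrict W hW).zeroIncl ≫ a.restrictι W hW :=
    pullback.lift_fst _ _ _
  have : IsOpenImmersion m := Scheme.pullback_map_isOpenImmersion ..
  have : LocallyOfFiniteType (a.restrict W hW).zeroFibre := locallyOfFiniteType_zeroFibre _
  rw [← Scheme.Hom.quasiFiniteLocus_eq_top_iff]
  refine top_le_iff.1 fun x _ => ?_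
  rw [Scheme.Hom.mem_quasiFiniteLocus, ← hm, Scheme.Hom.quasiFiniteAt_comp_iff_of_isOpenImmersion]
  refine h _ ?_
  rw [← Scheme.Hom.comp_apply, hm']
  exact ((a.restrict W hW).zeroIncl x).2

/-- The non-quasi-finite locus of the zero scheme is closed and misses `Z`, so its image can be
removed from `V`. Intersecting with a quasi-compact open neighbourhood of `Z` makes the result
Noetherian, which gives quasi-compactness. -/
theorem exists_isQuasiFinite_restrict {k : Type u} [Field k] {S X : Over (Spec (CommRingCat.of k))}
    {Y : Closeds X.left} [LocallyOfFiniteType S.hom] [QuasiCompact S.hom]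
    (a : ExplicitCorr n S X Y)
    (h : ∀ v, a.e v ∈ a.Z → IsolatedAt (a.e ≫ Aff.pr n S.left) a.φ v) :
    ∃ W hW, (a.restrict W hW).IsQuasiFinite := by
  have := a.nhd.etale
  have := a.locallyOfFiniteType_zeroFibre
  have := a.finite
  have : CompactSpace S.left := QuasiCompact.compactSpace_of_compactSpace S.hom
  have : IsLocallyNoetherian a.V :=
    LocallyOfFiniteType.isLocallyNoetherian (a.e ≫ Aff.pr n S.left ≫ S.hom)
  obtain ⟨K, hKc, hKo, hK, -⟩ := PrespectralSpace.exists_isCompact_and_isOpen_between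
    (isCompact_preimage_support a.nhd) isOpen_univ (Set.subset_univ _)
  let Q := a.zeroFibre.quasiFiniteLocus
  let W : a.V.Opens := ⟨K ∩ (a.zeroIncl '' (Q : Set _)ᶜ)ᶜ,
    hKo.inter (a.zeroIncl.isClosedEmbedding.isClosedMap _ Q.isOpen.isClosed_compl).isOpen_compl⟩
  have hW : ∀ v, a.e v ∈ a.Z → v ∈ W := by
    refine fun v hv => ⟨hK hv, ?_⟩
    rintro ⟨x, hx, rfl⟩
    exact hx (a.quasiFiniteAt_of_isolatedAt x (h _ hv))
  refine ⟨W, hW, locallyOfFiniteType_zeroFibre _, ?_, locallyQuasiFinite_zeroFibre_restrict _ _ _ ?_⟩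
  · let K' : a.V.Opens := ⟨K, hKo⟩
    have : CompactSpace K' := isCompact_iff_compactSpace.1 hKc
    have : IsNoetherian K'.toScheme := {}
    have : NoetherianSpace K := inferInstanceAs (NoetherianSpace K'.toScheme)
    have : NoetherianSpace (a.restrict W hW).V :=
      (Topology.IsEmbedding.inclusion (Set.inter_subset_left : (W : Set a.V) ⊆ K)).isInducing.noetherianSpace
    have : NoetherianSpace
        (pullback (a.restrict W hW).framing (zeroSection n S.left) : Scheme.{u}) :=
      (a.restrict W hW).zeroIncl.isClosedEmbedding.isInducing.noetherianSpace
    infer_instance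
  · intro x hx
    by_contra hx'
    exact hx.2 ⟨x, hx', rfl⟩

theorem mk_mem_frqf {k : Type u} [Field k] {S X : Over (Spec (CommRingCat.of k))}
    {Y : Closeds X.left} [LocallyOfFiniteType S.hom] [QuasiCompact S.hom]
    (a : ExplicitCorr n S X Y)
    (h : ∀ v, a.e v ∈ a.Z → IsolatedAt (a.e ≫ Aff.pr n S.left) a.φ v) :
    (Quot.mk _ a : Fr n S X Y) ∈ Frqf n S X Y := by
  obtain ⟨W, hW, hq⟩ := a.exists_isQuasiFinite_restrict h
  exact ⟨_, Quot.sound ⟨_, Refines.refl _, a.restrict_refines W hW⟩, hq⟩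

end

end ExplicitCorr

end FramedCorrespondence

/-! ### The admissible sections and the equations of `Y`. -/

namespace FramedCorrespondence

section Sections

open MvPolynomial

variable {k A : Type*} [CommRing k] [CommRing A] {n m r : ℕ}

/-- The form of degree `r + 1` which defines the `e`-th power of `xₗ`, respectively `yⱼ`. -/
noncomputable def powerForm (y : Fin m → A) (r e : ℕ) : Fin n ⊕ Fin m → MvPolynomial (Option (Fin n)) A
  | .inl l => X (some l) ^ e * X none ^ (r + 1 - e)
  | .inr j => C (y j ^ e) * X none ^ (r + 1)

theorem isHomogeneous_powerForm (y : Fin m → A) {e : ℕ} (he : e ≤ r + 1) (l : Fin n ⊕ Fin m) :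
    (powerForm y r e l).IsHomogeneous (r + 1) := by
  cases l with
  | inl l =>
    have h := ((isHomogeneous_X A (some l)).pow e).mul
      ((isHomogeneous_X A (none : Option (Fin n))).pow (r + 1 - e))
    rwa [show 1 * e + 1 * (r + 1 - e) = r + 1 by omega] at h
  | inr j =>
    have h := (isHomogeneous_C (Option (Fin n)) (y j ^ e)).mul
      ((isHomogeneous_X A (none : Option (Fin n))).pow (r + 1))
    rwa [show 0 + 1 * (r + 1) = r + 1 by omega] at h

theorem dehomogenize_powerForm (y : Fin m → A) (e : ℕ) (l : Fin n ⊕ Fin m) :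
    dehomogenize (powerForm y r e l) = Sum.elim X (fun j => C (y j)) l ^ e := by
  cases l <;> simp [dehomogenize, powerForm]

/-- The admissible sections `xᵢ + ∑ tᵢₗₑ wₗ ^ (e + 2)`, where `w` runs through the coordinates `x` and
the functions `y`. -/
noncomputable def perturbedSection (κ : k →+* A) (J : Ideal A) (y : Fin m → A) (hy : ∀ j, y j ∈ J)
    (t : Fin n × (Fin n ⊕ Fin m) × Fin r → k) : AdmissibleSection J n (r + 1) where
  -- The exponents run from 2, so that the added terms lie in the square of the ideal, to `r + 1`,
  -- the degree of the forms; the subtraction in `powerForm` is thus never truncated here.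
  s i := X (some i) * X none ^ r +
    ∑ l : (Fin n ⊕ Fin m) × Fin r, C (κ (t (i, l))) * powerForm y r (l.2 + 2) l.1
  isHomogeneous i := by
    refine .add ?_ (.sum _ _ _ fun l _ => ?_)
    · have h := (isHomogeneous_X A (some i)).mul
        ((isHomogeneous_X A (none : Option (Fin n))).pow r)
      rwa [show 1 + 1 * r = r + 1 by omega] at h
    · have h := (isHomogeneous_C (Option (Fin n)) (κ (t (i, l)))).mul
        (isHomogeneous_powerForm y (show (l.2 : ℕ) + 2 ≤ r + 1 by omega) l.1)
      rwa [zero_add] at h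
  congr i := by
    have h : dehomogenize (X (some i) * X none ^ r +
        ∑ l : (Fin n ⊕ Fin m) × Fin r, C (κ (t (i, l))) * powerForm y r (l.2 + 2) l.1) - X i =
        ∑ l : (Fin n ⊕ Fin m) × Fin r, C (κ (t (i, l))) *
          Sum.elim X (fun j => C (y j)) l.1 ^ ((l.2 : ℕ) + 2) := by
      simp only [← dehomogenize_powerForm (r := r)]
      simp [dehomogenize]
    rw [h]
    refine Ideal.sum_mem _ fun l _ => Ideal.mul_mem_left _ _ ?_
    rw [pow_add]
    refine Ideal.mul_mem_left _ _ (Ideal.pow_mem_pow ?_ 2)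
    obtain ⟨l | l, -⟩ := l
    · exact Ideal.mem_sup_left (Ideal.subset_span ⟨l, rfl⟩)
    · exact Ideal.mem_sup_right (Ideal.mem_map_of_mem _ (hy l))

theorem dehomogenize_perturbedSection (κ : k →+* A) (J : Ideal A) (y : Fin m → A)
    (hy : ∀ j, y j ∈ J) (t : Fin n × (Fin n ⊕ Fin m) × Fin r → k) (i : Fin n) :
    dehomogenize ((perturbedSection κ J y hy t).s i) = X i +
      ∑ l : (Fin n ⊕ Fin m) × Fin r, C (κ (t (i, l))) *
        Sum.elim X (fun j => C (y j)) l.1 ^ ((l.2 : ℕ) + 2) := by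
  simp only [← dehomogenize_powerForm (r := r)]
  simp [dehomogenize, perturbedSection]

theorem dehomogenize_map {A' : Type*} [CommRing A'] (f : A →+* A')
    (p : MvPolynomial (Option (Fin n)) A) : dehomogenize (map f p) = map f (dehomogenize p) := by
  unfold dehomogenize
  induction p using MvPolynomial.induction_on with
  | C a => simp
  | add p q hp hq => rw [map_add, map_add, map_add, map_add, hp, hq]
  | mul_X p o hp =>
    rw [map_mul, map_mul, map_X, map_mul, map_mul, hp, aeval_X, aeval_X]
    congr 1
    cases o <;> simp

/-- Written as `x + λ(s - x)`, the homotopy is itself a perturbation of `x`, scaled by `λ`. -/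
theorem dehomogenize_linearHomotopy {J : Ideal A} {d : ℕ} (s : AdmissibleSection J n d)
    (hd : 0 < d) (i : Fin n) : dehomogenize ((s.linearHomotopy hd).s i) =
      X i + C (Polynomial.X : Polynomial A) *
        (map (Polynomial.C : A →+* Polynomial A) (dehomogenize (s.s i)) - X i) := by
  rw [← dehomogenize_map]
  simp only [AdmissibleSection.linearHomotopy, dehomogenize, map_add, map_mul, map_pow, aeval_X,
    aeval_C, algebraMap_eq, Option.elim, one_pow, mul_one, map_sub, map_one]
  ring

end Sections

namespace ExplicitCorr

variable {B : Scheme.{u}} {n : ℕ} {S X : Over B} {Y : Closeds X.left}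

theorem twistφ_perturbedSection {k A : Type*} [CommRing k] [CommRing A] {m r : ℕ}
    (a : ExplicitCorr n S X Y) (θ : A →+* Γ(a.V, ⊤)) (κ : k →+* A) (J : Ideal A) (y : Fin m → A)
    (hy : ∀ j, y j ∈ J) (t : Fin n × (Fin n ⊕ Fin m) × Fin r → k) (i : Fin n) :
    a.twistφ θ (perturbedSection κ J y hy t) i = a.φ i +
      ∑ l : (Fin n ⊕ Fin m) × Fin r, θ (κ (t (i, l))) *
        Sum.elim a.φ (fun j => θ (y j)) l.1 ^ ((l.2 : ℕ) + 2) := by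
  have h : ∀ l : Fin n ⊕ Fin m, MvPolynomial.eval₂Hom θ a.φ
      (Sum.elim MvPolynomial.X (fun j => MvPolynomial.C (y j)) l) =
        Sum.elim a.φ (fun j => θ (y j)) l := by
    rintro (l | l) <;> simp
  unfold twistφ
  rw [dehomogenize_perturbedSection, ← MvPolynomial.coe_eval₂Hom]
  simp only [map_add, map_sum, map_mul, map_pow, h]
  simp

theorem twistφ_linearHomotopy {A : Type*} [CommRing A] {J : Ideal A} {d : ℕ}
    (a : ExplicitCorr n S X Y) (Θ : Polynomial A →+* Γ(a.V, ⊤)) (s : AdmissibleSection J n d)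
    (hd : 0 < d) (i : Fin n) : a.twistφ Θ (s.linearHomotopy hd) i =
      a.φ i + Θ Polynomial.X * (a.twistφ (Θ.comp Polynomial.C) s i - a.φ i) := by
  unfold twistφ
  rw [dehomogenize_linearHomotopy, ← MvPolynomial.coe_eval₂Hom, ← MvPolynomial.coe_eval₂Hom]
  simp [MvPolynomial.eval₂_map]

end ExplicitCorr

theorem IsolatedAt.restrict {S V : Scheme.{u}} {n : ℕ} {π : V ⟶ S} {φ : Fin n → Γ(V, ⊤)}
    (W : V.Opens) (w : W) (h : IsolatedAt π φ w.1) :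
    IsolatedAt (W.ι ≫ π) (fun i => W.ι.appTop (φ i)) w := by
  obtain ⟨O, hO, H⟩ := h
  refine ⟨W.ι ⁻¹ᵁ O, hO, fun v hv h₁ h₂ => Subtype.ext (H _ hv (fun i => ?_) ?_)⟩
  · exact (vanishesAt_appTop W.ι _ _).1 (h₁ i)
  · exact h₂

theorem VanishesAt.pow {V : Scheme.{u}} {f : Γ(V, ⊤)} {v : V} {N : ℕ} (h : VanishesAt (f ^ N) v) :
    VanishesAt f v := by
  unfold VanishesAt at h ⊢
  rw [map_pow] at h
  exact eq_zero_of_pow_eq_zero h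

/-- On affine `X`, a point off `Y` has a basic neighbourhood `D(f)` missing `Y`; then `f` is
nilpotent on `Y`, and a power of it lies in the ideal. -/
theorem mem_closedImage_iff {X Y : Scheme.{u}} [IsAffine X] (i : Y ⟶ X) [IsClosedImmersion i]
    (x : X) : x ∈ closedImage i ↔ ∀ f ∈ idealOf i, VanishesAt f x := by
  constructor
  · rintro ⟨y, rfl⟩ f hf
    rw [← vanishesAt_appTop, show i.appTop f = 0 from hf]
    exact map_zero (Y.Γevaluation y).hom
  · intro h
    by_contra hx
    obtain ⟨f, hf, hxf⟩ := (isAffineOpen_top X).exists_basicOpen_le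
      (V := ⟨_, (closedImage i).isClosed.isOpen_compl⟩) ⟨x, hx⟩ trivial
    have : IsAffine Y := isAffine_of_isAffineHom i
    have hb : Y.basicOpen (i.appTop f) = ⊥ := by
      rw [← Scheme.preimage_basicOpen_top]
      refine eq_bot_iff.2 fun y hy => ?_
      exact hf hy ⟨y, rfl⟩
    obtain ⟨N, hN⟩ := (Scheme.isNilpotent_iff_basicOpen_eq_bot (i.appTop f)).2 hb
    have hfN : f ^ N ∈ idealOf i := by
      rw [RingHom.mem_ker, map_pow]
      exact hN
    exact (vanishesAt_iff _ _).1 (h _ hfN).pow hxf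

theorem mem_closedImage_iff_of_span {X Y : Scheme.{u}} [IsAffine X] (i : Y ⟶ X)
    [IsClosedImmersion i] {m : ℕ} {y : Fin m → Γ(X, ⊤)}
    (hy : Ideal.span (Set.range y) = idealOf i) (x : X) :
    x ∈ closedImage i ↔ ∀ j, VanishesAt (y j) x := by
  rw [mem_closedImage_iff]
  constructor
  · exact fun h j => h _ (hy ▸ Ideal.subset_span ⟨j, rfl⟩)
  · intro h f hf
    have hle : Ideal.span (Set.range y) ≤ RingHom.ker (X.Γevaluation x).hom := by
      rw [Ideal.span_le]
      rintro _ ⟨j, rfl⟩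
      exact h j
    exact hle (hy ▸ hf)

theorem exists_span_range_eq_idealOf {k : Type u} [Field k] {X Y : Scheme.{u}} [IsAffine X]
    (p : X ⟶ Spec (CommRingCat.of k)) [LocallyOfFiniteType p] (i : Y ⟶ X) :
    ∃ (m : ℕ) (y : Fin m → Γ(X, ⊤)), Ideal.span (Set.range y) = idealOf i := by
  have : IsLocallyNoetherian X := LocallyOfFiniteType.isLocallyNoetherian p
  have : IsNoetherianRing Γ(X, ⊤) :=
    IsLocallyNoetherian.component_noetherian ⟨⊤, isAffineOpen_top X⟩
  obtain ⟨m, y, hy⟩ := Submodule.fg_iff_exists_fin_generating_family.1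
    (IsNoetherian.noetherian (idealOf i))
  exact ⟨m, y, hy⟩

end FramedCorrespondence

/-! ### Base change to the cylinder and the common core of (a) and (b). -/

namespace FramedCorrespondence

namespace ExplicitCorr

/-- The scheme `φ⁻¹(0)` of a pullback maps to that of the original correspondence. -/
theorem exists_zeroFibre_baseChange {B : Scheme.{u}} {n : ℕ} {S S' X : Over B} {Y : Closeds X.left}
    (h : S' ⟶ S) (a : ExplicitCorr n S X Y) :
    ∃ q, q ≫ a.zeroIncl = (a.baseChange h).zeroIncl ≫ pullback.fst a.e (affMap n h.left) ∧
      q ≫ a.zeroFibre = (a.baseChange h).zeroFibre ≫ h.left := by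
  let b := a.baseChange h
  let f : b.V ⟶ a.V := pullback.fst a.e (affMap n h.left)
  have hf : f ≫ a.e ≫ Aff.pr n S.left = b.e ≫ Aff.pr n S'.left ≫ h.left := by
    rw [← AffineSpace.map_over]
    exact pullback.condition_assoc _
  have hb : (b.zeroIncl ≫ f) ≫ a.framing = (b.zeroFibre ≫ h.left) ≫ zeroSection n S.left := by
    refine AffineSpace.hom_ext ?_ fun l => ?_
    · rw [Category.assoc, Category.assoc, Category.assoc, framing_pr, zeroSection_pr, hf,
        Category.comp_id, ← zeroIncl_comp, Category.assoc, Category.assoc]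
    · have h₁ : a.framing.appTop (AffineSpace.coord S.left l) = a.φ l.down :=
        AffineSpace.homOfVector_appTop_coord _ _ _
      have h₂ : (zeroSection n S.left).appTop (AffineSpace.coord S.left l) = 0 :=
        AffineSpace.homOfVector_appTop_coord _ _ _
      have h₃ : b.framing.appTop (AffineSpace.coord S'.left l) = f.appTop (a.φ l.down) :=
        AffineSpace.homOfVector_appTop_coord _ _ _
      have h₄ : (zeroSection n S'.left).appTop (AffineSpace.coord S'.left l) = 0 :=
        AffineSpace.homOfVector_appTop_coord _ _ _
      rw [Scheme.Hom.comp_appTop, Scheme.Hom.comp_appTop (b.zeroFibre ≫ h.left),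
        CommRingCat.comp_apply, CommRingCat.comp_apply, h₁, h₂, map_zero, Scheme.Hom.comp_appTop,
        CommRingCat.comp_apply, ← h₃]
      exact (appTop_congr pullback.condition _).trans (by rw [h₄, map_zero])
  exact ⟨pullback.lift _ _ hb, pullback.lift_fst _ _ _, pullback.lift_snd _ _ _⟩

/-- There is no need to identify the new zero scheme with the pullback of the old one. The
comparison map `l` is locally quasi-finite because composing it with `r` gives a closed immersion,
and the projection from the pullback is locally quasi-finite by base change. -/
theorem locallyQuasiFinite_zeroFibre_baseChange {B : Scheme.{u}} {n : ℕ} {S S' X : Over B}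
    {Y : Closeds X.left} (h : S' ⟶ S) (a : ExplicitCorr n S X Y)
    [LocallyQuasiFinite a.zeroFibre] : LocallyQuasiFinite (a.baseChange h).zeroFibre := by
  obtain ⟨q, hq, hq'⟩ := a.exists_zeroFibre_baseChange h
  let b := a.baseChange h
  let f : b.V ⟶ a.V := pullback.fst a.e (affMap n h.left)
  have hP : IsPullback f (b.e ≫ Aff.pr n S'.left)
      (a.e ≫ Aff.pr n S.left) h.left :=
    (IsPullback.of_hasPullback a.e (affMap n h.left)).paste_vert
      (AffineSpace.isPullback_map (n := ULift.{u} (Fin n)) h.left)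
  let r : pullback a.zeroFibre h.left ⟶ b.V := hP.lift (pullback.fst _ _ ≫ a.zeroIncl)
    (pullback.snd _ _) (by rw [Category.assoc, zeroIncl_comp, pullback.condition])
  let l : pullback b.framing (zeroSection n S'.left) ⟶ pullback a.zeroFibre h.left :=
    pullback.lift q b.zeroFibre hq'
  have hlr : l ≫ r = b.zeroIncl := by
    refine hP.hom_ext ?_ ?_
    · rw [Category.assoc, hP.lift_fst, pullback.lift_fst_assoc, hq]
    · rw [Category.assoc, hP.lift_snd, pullback.lift_snd, zeroIncl_comp]
  have : LocallyQuasiFinite (l ≫ r) := by rw [hlr]; infer_instance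
  have : LocallyQuasiFinite l := .of_comp l r
  have hl : l ≫ pullback.snd a.zeroFibre h.left = b.zeroFibre := pullback.lift_snd _ _ _
  rw [← hl]
  infer_instance

section

variable {k : Type u} [Field k] [Infinite k] {n : ℕ} {S X : Over (Spec (CommRingCat.of k))}
  [LocallyOfFiniteType S.hom] [QuasiCompact S.hom] [LocallyOfFiniteType X.hom] [IsAffine X.left]
  {Y : Scheme.{u}} (i : Y ⟶ X.left) [IsClosedImmersion i]

/-- Serves (a) with `c = 1` and (b) with `c = λ`. Isolatedness for the original framing is demanded
only over the zeros of `c`; elsewhere a general perturbation provides it. -/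
theorem exists_section_isolatedAt (a : ExplicitCorr n S X (closedImage i)) (c : Γ(S.left, ⊤))
    (hc : ∀ v, a.e v ∈ a.Z → VanishesAt c ((a.e ≫ Aff.pr n S.left) v) →
      IsolatedAt (a.e ≫ Aff.pr n S.left) a.φ v) :
    ∃ (d : ℕ) (_ : 0 < d) (s : AdmissibleSection (idealOf i) n d), ∀ v, a.e v ∈ a.Z →
      IsolatedAt (a.e ≫ Aff.pr n S.left) (fun j => a.φ j +
        (a.e ≫ Aff.pr n S.left).appTop c * (a.twistφ a.g.appTop.hom s j - a.φ j)) v := by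
  have := a.nhd.etale
  have : CompactSpace S.left := QuasiCompact.compactSpace_of_compactSpace S.hom
  obtain ⟨m, y, hy⟩ := exists_span_range_eq_idealOf X.hom i
  have hyJ : ∀ j, y j ∈ idealOf i := fun j => hy ▸ Ideal.subset_span ⟨j, rfl⟩
  let f : Fin n ⊕ Fin m → Γ(a.V, ⊤) := Sum.elim a.φ fun j => a.g.appTop (y j)
  have hf : ∀ v, a.e v ∈ a.Z ↔ ∀ j, VanishesAt (f j) v := fun v => by
    rw [a.support, mem_closedImage_iff_of_span i hy, Sum.forall]
    simp only [f, Sum.elim_inl, Sum.elim_inr, vanishesAt_appTop]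
  have hconst : ∀ x, a.g.appTop (constFun X.hom x) =
      constFun ((a.e ≫ Aff.pr n S.left) ≫ S.hom) x := fun x => by
    refine (appTop_congr (f' := 𝟙 _) (g' := (a.e ≫ Aff.pr n S.left) ≫ S.hom) ?_ _).trans (by simp; rfl)
    rw [Category.id_comp, Category.assoc, a.g_over]
  obtain ⟨r, t, ht⟩ := exists_isolatedAt_perturb S.hom a.e a.finite a.nhd a.φ
    ((a.e ≫ Aff.pr n S.left).appTop c) f (fun v hv => ((a.support v).1 hv).1) hf
  have key : ∀ j, a.φ j + (a.e ≫ Aff.pr n S.left).appTop c * (a.twistφ a.g.appTop.hom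
      (perturbedSection (constFun X.hom) (idealOf i) y hyJ t) j - a.φ j) =
      perturb ((a.e ≫ Aff.pr n S.left) ≫ S.hom) a.φ ((a.e ≫ Aff.pr n S.left).appTop c) f t j := by
    intro j
    rw [twistφ_perturbedSection, add_sub_cancel_left]
    unfold perturb
    congr 2
    refine Finset.sum_congr rfl fun l _ => ?_
    congr 1
    exact hconst _
  refine ⟨r + 1, r.succ_pos, perturbedSection (constFun X.hom) (idealOf i) y hyJ t, fun v hv => ?_⟩
  by_cases hcv : VanishesAt c ((a.e ≫ Aff.pr n S.left) v)
  · obtain ⟨O, hO, H⟩ := hc v hv hcv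
    refine ⟨O, hO, fun v' hv' h₁ h₂ => H v' hv' (fun j => ?_) h₂⟩
    -- Since `c` comes from the base, it vanishes at every point of the fibre through `v`, where the
    -- perturbed framing therefore has the same values as `φ`.
    have h₃ : VanishesAt ((a.e ≫ Aff.pr n S.left).appTop c) v' := by
      rw [vanishesAt_appTop, h₂]
      exact hcv
    have h₄ := h₁ j
    unfold VanishesAt at h₃ h₄ ⊢
    rwa [map_add, map_mul, h₃, zero_mul, add_zero] at h₄
  · simp only [key]
    exact ht v hv (by rwa [vanishesAt_appTop])

end

end ExplicitCorr

end FramedCorrespondence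

theorem mainTheorem5 {k : Type u} [Field k] [Infinite k] (n : ℕ)
    (U X : Over (Spec (CommRingCat.of k))) (hU : IsSm U) (hX : IsSm X) [IsAffine X.left]
    {Y : Scheme.{u}} (i : Y ⟶ X.left) [IsClosedImmersion i] :
    (∀ φ : Fr n U X (closedImage i),
      ∃ (d : ℕ) (_ : 0 < d) (s : AdmissibleSection (idealOf i) n d),
        φ.twist i s ∈ Frqf n U X (closedImage i)) ∧
    (∀ φ ∈ Frqf n U X (closedImage i),
      ∃ (d : ℕ) (hd : 0 < d) (s : AdmissibleSection (idealOf i) n d),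
        φ.linearHomotopy i s hd ∈ Frqf n (cylinder U) X (closedImage i)) := by
  have := hU.smooth
  have := hU.quasiCompact
  have := hX.smooth
  refine ⟨fun φ => ?_, ?_⟩
  · obtain ⟨a, rfl⟩ := Quot.exists_rep φ
    -- With `c = 1` the condition over the zeros of `c` is vacuous, and the framing `φ + (φ^s - φ)`
    -- is `φ^s`.
    obtain ⟨d, hd, s, hs⟩ := a.exists_section_isolatedAt i 1 fun v _ h => by
      rw [VanishesAt, map_one] at h
      exact absurd h one_ne_zero
    refine ⟨d, hd, s, ExplicitCorr.mk_mem_frqf _ fun v hv => ?_⟩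
    have h := (hs v.1 hv).restrict (a.twistOpen a.g.appTop.hom (a.compatible_g i) s) v
    simp only [map_one, one_mul, add_sub_cancel] at h
    exact h
  · rintro _ ⟨a, rfl, ha⟩
    have := ha.locallyQuasiFinite
    have : LocallyOfFiniteType (cylinder U).hom :=
      inferInstanceAs (LocallyOfFiniteType (Aff.pr 1 U.left ≫ U.hom))
    have : QuasiCompact (cylinder U).hom :=
      inferInstanceAs (QuasiCompact (Aff.pr 1 U.left ≫ U.hom))
    let b := a.baseChange (cylinderPr U)
    -- With `c = λ` the condition holds at all points of the support, because the pullback of a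
    -- quasi-finite representative to the cylinder still has a locally quasi-finite zero scheme.
    obtain ⟨d, hd, s, hs⟩ := b.exists_section_isolatedAt i (cylinderCoord U) fun v hv _ =>
      ExplicitCorr.isolatedAt_of_isQuasiFinite
        (a.locallyQuasiFinite_zeroFibre_baseChange (cylinderPr U)) v ((b.support v).1 hv).1
    refine ⟨d, hd, s, ExplicitCorr.mk_mem_frqf (b.twist (b.evalFamily (cylinderCoord U))
      (b.compatible_evalFamily i _) (s.linearHomotopy hd)) fun v hv => ?_⟩
    have h := (hs v.1 hv).restrict (b.twistOpen (b.evalFamily (cylinderCoord U))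
      (b.compatible_evalFamily i _) (s.linearHomotopy hd)) v
    have hC : (b.evalFamily (cylinderCoord U)).comp Polynomial.C = b.g.appTop.hom :=
      RingHom.ext fun x => Polynomial.eval₂_C _ _
    have hX : b.evalFamily (cylinderCoord U) Polynomial.X =
        (b.e ≫ Aff.pr n (cylinder U).left).appTop (cylinderCoord U) := Polynomial.eval₂_X _ _
    simp only [← hC, ← hX, ← ExplicitCorr.twistφ_linearHomotopy _ _ s hd] at h
    exact h
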